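/- Let $G$ be a finite connected graph (loops and multiple edges allowed) with vertex weights $g_w\in\mathbb Z_{\ge 0}$ and edge lengths $\ell(e)>0$, and let $\Gamma$ be the associated metric graph. (One thinks of $G$ as the dual graph of a connected nodal curve $X$ with components $X_w$ whose normalizations have genus $g_w$, and of $\Gamma$ as the skeleton of a smoothing of $X$.) Fix a polarization $H\colon V(G)\to\mathbb Z_{>0}$, an integer $n$, a vertex $v$, and a base vertex $v'$. *Types and stability.* A type is a pair $(S,\underline d)$ with $S\subset E(G)$ and $\underline d\in\mathbb Z^{V(G)}$; it stands for a rank 1 torsion free sheaf $F$ on $X$ that fails to be locally free exactly at the nodes in $S$ and has multidegree $\underline d$. For non-empty sets of vertices (subcurves) $W\subset Y$, the subsheaf $F_W$ of sections supported on $W$ of a sheaf $F$ of type $(S,\underline d)$ on $Y$ has slope $$m(F_W)=\frac{\sum_{w\in W}\underline d_w+|S\cap E(W)|-|E(W,Y\setminus W)\setminus S|+1-g(W)}{\sum_{w\in W}H(w)},\qquad g(W)=1-|W|+|E(W)|+\sum_{w\in W}g_w,$$ where $E(W)$ is the set of edges with both ends in $W$ and $E(W,Y\setminus W)$ is the set of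 edges joining $W$ to $Y\setminus W$. The sheaf $F$ on $Y$ is semistable (stable) if $m(F_W)\le m(F)$ (resp. $<$) for all non-empty $W\subsetneq Y$, where $m(F)=m(F_Y)$. A type $(S,\underline d)$ on $X$ is $v$-quasistable if it is semistable and $v\notin Y$ whenever $\emptyset\ne Y\subsetneq V(G)$ and $m(F_Y)=m(F)$. It is polystable if it is semistable and equals the type of $\operatorname{Gr}(F)=\bigoplus_j F_{Z_{j+1}}/F_{Z_j}$ for some Jordan–Hölder filtration, given by $\emptyset=Z_0\subsetneq\dots\subsetneq Z_k=V(G)$ such that each $F_{Z_{j+1}}/F_{Z_j}$ is a stable sheaf on $Z_{j+1}\setminus Z_j$ of slope $m(F)$. Here $F_{Z_{j+1}}/F_{Z_j}$ fails to be locally free at the edges in $S\cap E(Z_{j+1}\setminus Z_j)$ and has degree $\underline d_w-|E(\{w\},V(G)\setminus Z_{j+1})\setminus S|$ at $w\in Z_{j+1}\setminus Z_j$, and $\operatorname{Gr}(F)$ fails to be locally free at the edges in $S$ and at all edges joining different pieces. *Cells.* A divisor on $\Gamma$ is of type $(S,\underline d)$ if it is the sum of $\underline d$ and one point in the interior of each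 edge in $S$. Let $\operatorname{Pic}^n(\Gamma)$ be the set of divisors of degree $n$ modulo divisors of piecewise linear functions with integer slopes, with the topology given by the tropical Abel–Jacobi map with base point $v'$ to the real torus $\Omega(\Gamma)^*/\Lambda$, where $\Omega(\Gamma)$ is the space of harmonic $1$-forms and $\Lambda$ is the image of $H_1(G,\mathbb Z)$ under integration. Let $\theta_{S,\underline d}\subset\operatorname{Pic}^n(\Gamma)$ be the closure of the set of classes of divisors of type $(S,\underline d)$. Let $\Delta_{\mathrm{ps}}$ (resp. $\Delta_{\mathrm{qs}}$) be the set of all $\theta_{S,\underline d}$ with $(S,\underline d)$ polystable (resp. $v$-quasistable) and $|S|+\sum_w\underline d_w=n$. Orient the edges, and let $\widetilde\Delta_{\mathrm{ps}}$ (resp. $\widetilde\Delta_{\mathrm{qs}}$) be the set of the zonotopes $$Q_{S,\underline d}(\xi)=\Big\{\int_\xi+\sum_{e\in S}\frac{t_e}{\ell(e)}\int_e\;:\;0\le t_e\le\ell(e)\Big\}\subset\Omega(\Gamma)^*$$ for the same pairs and for all $\xi\in C_1(G,\mathbb Z)$ with $\partial\xi=\underline d+\sum_{e\in S}(\text{source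 of }e)-n\,v'$; these are the lifts of the cells $\theta_{S,\underline d}$. **Claim.** The decomposition $\Delta_{\mathrm{qs}}$ of $\operatorname{Pic}^n(\Gamma)$ is a refinement of $\Delta_{\mathrm{ps}}$, and the periodic decomposition $\widetilde\Delta_{\mathrm{qs}}$ of $\Omega(\Gamma)^*$ is a refinement of $\widetilde\Delta_{\mathrm{ps}}$. That is, in each of the two cases both families cover the whole space, every cell of the first family is contained in a cell of the second, and every cell of the second family is the union of the cells of the first that it contains. -/

import Mathlib

/-- A finite connected vertex-weighted graph with positive edge lengths (loops and multiple edges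
allowed), with a chosen orientation of each edge. It is the dual graph of a connected nodal curve:
`genus w` is the genus of the normalization of the component `w`. -/
structure MetricGraph (V E : Type*) where
  src : E → V
  tgt : E → V
  len : E → ℝ
  len_pos : ∀ e, 0 < len e
  genus : V → ℕ
  connected : ∀ u w : V, Relation.EqvGen (fun a b => ∃ e, src e = a ∧ tgt e = b) u w

namespace MetricGraph

set_option linter.unusedSectionVars false

noncomputable section

variable {V E : Type*} [Fintype V] [Fintype E] [DecidableEq V] [DecidableEq E]
variable (Γ : MetricGraph V E)

/-! ### Types of rank one torsion free sheaves and their stability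

A subcurve is given by the set of its components, a `Finset V`. A type is a pair `(S, d)` with
`S : Finset E` (the nodes at which the sheaf is not locally free) and `d : V → ℤ` (its multidegree).
-/

/-- The nodes of the subcurve `Y`: edges with both ends in `Y`. -/
def innerEdges (Y : Finset V) : Finset E :=
  Finset.univ.filter fun e => Γ.src e ∈ Y ∧ Γ.tgt e ∈ Y

/-- The edges with one end in `Y` and the other in `Z` (used for disjoint `Y`, `Z`). -/
def cutEdges (Y Z : Finset V) : Finset E :=
  Finset.univ.filter fun e =>
    (Γ.src e ∈ Y ∧ Γ.tgt e ∈ Z) ∨ (Γ.src e ∈ Z ∧ Γ.tgt e ∈ Y)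

/-- Arithmetic genus of the subcurve `Y`, that is, `1 - χ(O_Y)`. -/
def arithGenus (Y : Finset V) : ℤ :=
  1 - (Y.card : ℤ) + ((Γ.innerEdges Y).card : ℤ) + ∑ w ∈ Y, (Γ.genus w : ℤ)

/-- For a sheaf `F` of type `(S, d)` on the curve `Y`, and `W ⊆ Y`: the degree of the subsheaf
`F_W` of sections supported on `W`. For `W = Y` this is the degree of `F`. -/
def subDegree (S : Finset E) (d : V → ℤ) (Y W : Finset V) : ℤ :=
  ∑ w ∈ W, d w + ((S ∩ Γ.innerEdges W).card : ℤ) - ((Γ.cutEdges W (Y \ W) \ S).card : ℤ)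

/-- The slope of `F_W`, for `F` of type `(S, d)` on `Y` and the polarization of multidegree `H`. -/
def slope (H : V → ℕ) (S : Finset E) (d : V → ℤ) (Y W : Finset V) : ℚ :=
  ((Γ.subDegree S d Y W + 1 - Γ.arithGenus W : ℤ) : ℚ) / (∑ w ∈ W, (H w : ℚ))

/-- Semistability of the type `(S, d)` on the whole curve. -/
def IsSemistable (H : V → ℕ) (S : Finset E) (d : V → ℤ) : Prop :=
  ∀ Y : Finset V, Y.Nonempty → Y ≠ Finset.univ →
    Γ.slope H S d Finset.univ Y ≤ Γ.slope H S d Finset.univ Finset.univ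

/-- Stability of a sheaf on the subcurve `Y`, of multidegree `d` on `Y` and not locally free exactly
at the nodes of `Y` lying in `S`, for the restricted polarization. -/
def IsStableOn (H : V → ℕ) (S : Finset E) (d : V → ℤ) (Y : Finset V) : Prop :=
  ∀ W : Finset V, W.Nonempty → W ⊂ Y → Γ.slope H S d Y W < Γ.slope H S d Y Y

/-- `v`-quasistability of the type `(S, d)`. -/
def IsQuasistable (H : V → ℕ) (v : V) (S : Finset E) (d : V → ℤ) : Prop :=
  Γ.IsSemistable H S d ∧
    ∀ Y : Finset V, Y.Nonempty → Y ≠ Finset.univ →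
      Γ.slope H S d Finset.univ Y = Γ.slope H S d Finset.univ Finset.univ → v ∉ Y

/-- Multidegree of the subsheaf `F_Z` on the components of `Z`, for `F` of type `(S, d)`. It is also
the multidegree of the quotient `F_Z / F_Z'` on the components of `Z \ Z'`, for `Z' ⊂ Z`. -/
def subMultidegree (S : Finset E) (d : V → ℤ) (Z : Finset V) (w : V) : ℤ :=
  d w - ((Γ.cutEdges {w} Zᶜ \ S).card : ℤ)

/-- `0 = F_{Z 0} ⊂ F_{Z 1} ⊂ ⋯ ⊂ F_{Z k} = F` is a Jordan–Hölder filtration of the sheaves `F` of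
type `(S, d)`: each quotient `F_{Z (j+1)} / F_{Z j}` is a stable sheaf on the subcurve
`Z (j+1) \ Z j`, of the same slope as `F`. -/
structure IsJordanHolder (H : V → ℕ) (S : Finset E) (d : V → ℤ) (k : ℕ)
    (Z : ℕ → Finset V) : Prop where
  zero : Z 0 = ∅
  last : Z k = Finset.univ
  strict : ∀ j < k, Z j ⊂ Z (j + 1)
  stable : ∀ j < k,
    Γ.IsStableOn H S (Γ.subMultidegree S d (Z (j + 1))) (Z (j + 1) \ Z j)
  slope_eq : ∀ j < k,
    Γ.slope H S (Γ.subMultidegree S d (Z (j + 1))) (Z (j + 1) \ Z j) (Z (j + 1) \ Z j) =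
      Γ.slope H S d Finset.univ Finset.univ

/-- The associated graded sheaf `⨁ F_{Z (j+1)} / F_{Z j}` has type `(S₁, d₁)`: it fails to be locally
free at the nodes in `S` and at the nodes joining different pieces. -/
def IsGradedType (S : Finset E) (d : V → ℤ) (k : ℕ) (Z : ℕ → Finset V)
    (S₁ : Finset E) (d₁ : V → ℤ) : Prop :=
  (∀ e, e ∈ S₁ ↔ e ∈ S ∨ ∃ j < k, e ∈ Γ.cutEdges (Z j) (Z j)ᶜ) ∧
    ∀ j < k, ∀ w ∈ Z (j + 1) \ Z j, d₁ w = Γ.subMultidegree S d (Z (j + 1)) w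

/-- Polystability of the type `(S, d)`: it is semistable and agrees with the type of its associated
graded. (A sheaf `F` of type `(S, d)` is isomorphic to `Gr F` if and only if the types agree, since
`F` splits along a set of nodes at which it is not locally free.) -/
def IsPolystable (H : V → ℕ) (S : Finset E) (d : V → ℤ) : Prop :=
  Γ.IsSemistable H S d ∧
    ∃ (k : ℕ) (Z : ℕ → Finset V), Γ.IsJordanHolder H S d k Z ∧ Γ.IsGradedType S d k Z S d

/-! ### Divisors on the metric graph -/

/-- The points of the metric graph: vertices, and interior points of edges, given by the distance
from the source of the edge. -/
abbrev Point : Type _ := V ⊕ (Σ e : E, Set.Ioo (0 : ℝ) (Γ.len e))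

/-- Divisors on the metric graph. -/
abbrev Divisor : Type _ := Γ.Point →₀ ℤ

/-- The degree of a divisor. -/
def degree (D : Γ.Divisor) : ℤ := D.sum fun _ n => n

/-- The point of the (closed) edge `e` at distance `t ∈ [0, len e]` from its source. -/
def edgePoint (e : E) (t : ℝ) : Γ.Point :=
  if h : 0 < t ∧ t < Γ.len e then Sum.inr ⟨e, ⟨t, h⟩⟩
  else if t ≤ 0 then Sum.inl (Γ.src e) else Sum.inl (Γ.tgt e)

/-- `φ` is affine of slope `s` on some interval `[t, t + ε]`. -/
def HasRightSlope (φ : ℝ → ℝ) (t : ℝ) (s : ℤ) : Prop :=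
  ∃ ε > 0, ∀ u ∈ Set.Icc (0 : ℝ) ε, φ (t + u) = φ t + s * u

/-- `φ` is affine on some interval `[t - ε, t]`, with slope `s` in the direction leaving `t`. -/
def HasLeftSlope (φ : ℝ → ℝ) (t : ℝ) (s : ℤ) : Prop :=
  ∃ ε > 0, ∀ u ∈ Set.Icc (0 : ℝ) ε, φ (t - u) = φ t + s * u

/-- `f` is a (continuous) piecewise linear function with integer slopes, and `D` is its divisor: the
value of `D` at a point is the sum of the outgoing slopes of `f`. The numbers `r e t` and `l e t`
are the slopes of `f` at the point `t` of the edge `e` in the two directions leaving that point.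
(By compactness of `[0, len e]`, there are finitely many breakpoints.) -/
def IsDivisorOf (f : Γ.Point → ℝ) (D : Γ.Divisor) : Prop :=
  ∃ r l : E → ℝ → ℤ,
    (∀ e, ∀ t ∈ Set.Ico (0 : ℝ) (Γ.len e),
      HasRightSlope (fun x => f (Γ.edgePoint e x)) t (r e t)) ∧
    (∀ e, ∀ t ∈ Set.Ioc (0 : ℝ) (Γ.len e),
      HasLeftSlope (fun x => f (Γ.edgePoint e x)) t (l e t)) ∧
    (∀ e, ∀ t : Set.Ioo (0 : ℝ) (Γ.len e), D (Sum.inr ⟨e, t⟩) = r e t + l e t) ∧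
    ∀ w, D (Sum.inl w) = ∑ e with Γ.src e = w, r e 0 + ∑ e with Γ.tgt e = w, l e (Γ.len e)

theorem HasRightSlope.add {φ ψ : ℝ → ℝ} {t : ℝ} {a b : ℤ} (h : HasRightSlope φ t a)
    (k : HasRightSlope ψ t b) : HasRightSlope (fun x => φ x + ψ x) t (a + b) := by
  obtain ⟨ε, hε, h⟩ := h
  obtain ⟨δ, hδ, k⟩ := k
  refine ⟨min ε δ, lt_min hε hδ, fun u hu => ?_⟩
  have h1 := h u ⟨hu.1, hu.2.trans (min_le_left _ _)⟩
  have h2 := k u ⟨hu.1, hu.2.trans (min_le_right _ _)⟩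
  simp only [h1, h2]; push_cast; ring

theorem HasLeftSlope.add {φ ψ : ℝ → ℝ} {t : ℝ} {a b : ℤ} (h : HasLeftSlope φ t a)
    (k : HasLeftSlope ψ t b) : HasLeftSlope (fun x => φ x + ψ x) t (a + b) := by
  obtain ⟨ε, hε, h⟩ := h
  obtain ⟨δ, hδ, k⟩ := k
  refine ⟨min ε δ, lt_min hε hδ, fun u hu => ?_⟩
  have h1 := h u ⟨hu.1, hu.2.trans (min_le_left _ _)⟩
  have h2 := k u ⟨hu.1, hu.2.trans (min_le_right _ _)⟩
  simp only [h1, h2]; push_cast; ring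

theorem HasRightSlope.neg {φ : ℝ → ℝ} {t : ℝ} {a : ℤ} (h : HasRightSlope φ t a) :
    HasRightSlope (fun x => -φ x) t (-a) := by
  obtain ⟨ε, hε, h⟩ := h
  refine ⟨ε, hε, fun u hu => ?_⟩
  simp only [h u hu]; push_cast; ring

theorem HasLeftSlope.neg {φ : ℝ → ℝ} {t : ℝ} {a : ℤ} (h : HasLeftSlope φ t a) :
    HasLeftSlope (fun x => -φ x) t (-a) := by
  obtain ⟨ε, hε, h⟩ := h
  refine ⟨ε, hε, fun u hu => ?_⟩
  simp only [h u hu]; push_cast; ring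

/-- The group of principal divisors. -/
def principal : AddSubgroup Γ.Divisor where
  carrier := {D | ∃ f, Γ.IsDivisorOf f D}
  zero_mem' := ⟨fun _ => 0, fun _ _ => 0, fun _ _ => 0,
    fun _ _ _ => ⟨1, one_pos, by simp⟩, fun _ _ _ => ⟨1, one_pos, by simp⟩, by simp, by simp⟩
  add_mem' := by
    rintro D D' ⟨f, r, l, h1, h2, h3, h4⟩ ⟨f', r', l', h1', h2', h3', h4'⟩
    refine ⟨fun p => f p + f' p, fun e t => r e t + r' e t, fun e t => l e t + l' e t,
      fun e t ht => (h1 e t ht).add (h1' e t ht), fun e t ht => (h2 e t ht).add (h2' e t ht),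
      fun e t => ?_, fun w => ?_⟩
    · rw [Finsupp.add_apply, h3, h3']; ring
    · rw [Finsupp.add_apply, h4, h4', Finset.sum_add_distrib, Finset.sum_add_distrib]; ring
  neg_mem' := by
    rintro D ⟨f, r, l, h1, h2, h3, h4⟩
    refine ⟨fun p => -f p, fun e t => -r e t, fun e t => -l e t,
      fun e t ht => (h1 e t ht).neg, fun e t ht => (h2 e t ht).neg, fun e t => ?_, fun w => ?_⟩
    · rw [Finsupp.neg_apply, h3]; ring
    · rw [Finsupp.neg_apply, h4, Finset.sum_neg_distrib, Finset.sum_neg_distrib]; ring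

/-- `Pic^n`: divisors of degree `n` up to linear equivalence. -/
def Pic (n : ℤ) : Type _ :=
  {x : Γ.Divisor ⧸ Γ.principal // ∃ D : Γ.Divisor, Γ.degree D = n ∧ (D : Γ.Divisor ⧸ Γ.principal) = x}

/-- The divisor `d + ∑_{e ∈ S} (point of e at distance t e from its source)`. -/
def typeDivisor (S : Finset E) (d : V → ℤ) (t : ∀ e : E, Set.Ioo (0 : ℝ) (Γ.len e)) : Γ.Divisor :=
  ∑ w, Finsupp.single (Sum.inl w) (d w) + ∑ e ∈ S, Finsupp.single (Sum.inr ⟨e, t e⟩) 1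

/-- `D` is a divisor of type `(S, d)`. -/
def IsOfType (S : Finset E) (d : V → ℤ) (D : Γ.Divisor) : Prop :=
  ∃ t : ∀ e : E, Set.Ioo (0 : ℝ) (Γ.len e), D = Γ.typeDivisor S d t

/-! ### The tropical Jacobian -/

/-- The boundary map `C_1(G, R) → C_0(G, R)`. -/
def boundary {R : Type*} [AddCommGroup R] (ξ : E → R) (w : V) : R :=
  ∑ e with Γ.tgt e = w, ξ e - ∑ e with Γ.src e = w, ξ e

theorem boundary_add {R : Type*} [AddCommGroup R] (ξ η : E → R) :
    Γ.boundary (ξ + η) = Γ.boundary ξ + Γ.boundary η := by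
  funext w
  simp only [boundary, Pi.add_apply, Finset.sum_add_distrib]; abel

theorem boundary_neg {R : Type*} [AddCommGroup R] (ξ : E → R) :
    Γ.boundary (-ξ) = -Γ.boundary ξ := by
  funext w
  simp only [boundary, Pi.neg_apply, Finset.sum_neg_distrib]; abel

theorem boundary_zero {R : Type*} [AddCommGroup R] : Γ.boundary (0 : E → R) = 0 := by
  funext w
  simp [boundary]

theorem boundary_smul {R : Type*} [CommRing R] (a : R) (ξ : E → R) :
    Γ.boundary (a • ξ) = a • Γ.boundary ξ := by
  funext w
  simp only [boundary, Pi.smul_apply, smul_eq_mul, ← Finset.mul_sum]; ring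

/-- Harmonic `1`-forms `∑ ω_e de`: at each vertex the outgoing coefficients sum to zero. -/
def harmonicForms : Submodule ℝ (E → ℝ) where
  carrier := {ω | Γ.boundary ω = 0}
  zero_mem' := Γ.boundary_zero
  add_mem' := fun {a b} ha hb => by
    change Γ.boundary (a + b) = 0
    rw [boundary_add, show Γ.boundary a = 0 from ha, show Γ.boundary b = 0 from hb, add_zero]
  smul_mem' := fun c a ha => by
    change Γ.boundary (c • a) = 0
    rw [boundary_smul, show Γ.boundary a = 0 from ha, smul_zero]

/-- The dual of the (finite-dimensional) space of harmonic forms, with its norm topology. -/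
def FormsDual : Type _ := Γ.harmonicForms →L[ℝ] ℝ

instance : NormedAddCommGroup Γ.FormsDual :=
  inferInstanceAs (NormedAddCommGroup (Γ.harmonicForms →L[ℝ] ℝ))

instance : NormedSpace ℝ Γ.FormsDual :=
  inferInstanceAs (NormedSpace ℝ (Γ.harmonicForms →L[ℝ] ℝ))

/-- Evaluation of a functional at a harmonic form. -/
def evalForm (ω : Γ.harmonicForms) : Γ.FormsDual →ₗ[ℝ] ℝ where
  toFun x := (show Γ.harmonicForms →L[ℝ] ℝ from x) ω
  map_add' _ _ := rfl
  map_smul' _ _ := rfl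

theorem formsDual_ext {x y : Γ.FormsDual} (h : ∀ ω, Γ.evalForm ω x = Γ.evalForm ω y) : x = y :=
  ContinuousLinearMap.ext h

/-- The functional sending `ω = ∑ ω_e de` to the coefficient `ω_e`. -/
def coeffForm (e : E) : Γ.FormsDual :=
  (ContinuousLinearMap.proj (R := ℝ) (φ := fun _ : E => ℝ) e).comp Γ.harmonicForms.subtypeL

theorem evalForm_coeffForm (e : E) (ω : Γ.harmonicForms) :
    Γ.evalForm ω (Γ.coeffForm e) = (ω : E → ℝ) e := rfl

/-- Integration along a `1`-chain: `ω = ∑ ω_e de` is sent to `∑ ξ_e ω_e (len e)`. -/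
def integral : (E → ℝ) →ₗ[ℝ] Γ.FormsDual where
  toFun ξ := ∑ e, (ξ e * Γ.len e) • Γ.coeffForm e
  map_add' ξ η := by simp only [Pi.add_apply, add_mul, add_smul, Finset.sum_add_distrib]
  map_smul' a ξ := by
    simp only [Pi.smul_apply, smul_eq_mul, mul_assoc, mul_smul, Finset.smul_sum, RingHom.id_apply]

theorem integral_apply (ξ : E → ℝ) (ω : Γ.harmonicForms) :
    Γ.evalForm ω (Γ.integral ξ) = ∑ e, ξ e * Γ.len e * (ω : E → ℝ) e := by
  simp [integral, evalForm_coeffForm]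

/-- Integration along an integral `1`-chain. -/
def intIntegral : (E → ℤ) →+ Γ.FormsDual where
  toFun ξ := Γ.integral fun e => (ξ e : ℝ)
  map_zero' := by
    simp only [Pi.zero_apply, Int.cast_zero]
    exact Γ.integral.map_zero
  map_add' ξ η := by
    rw [← map_add]
    congr 1
    funext e
    simp

/-- The lattice `Λ`, the image of `H_1(G, ℤ)`. -/
def lattice : AddSubgroup Γ.FormsDual where
  carrier := {x | ∃ ξ : E → ℤ, Γ.boundary ξ = 0 ∧ Γ.intIntegral ξ = x}
  zero_mem' := ⟨0, Γ.boundary_zero, map_zero _⟩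
  add_mem' := by
    rintro _ _ ⟨ξ, hξ, rfl⟩ ⟨η, hη, rfl⟩
    exact ⟨ξ + η, by rw [boundary_add, hξ, hη, add_zero], map_add _ _ _⟩
  neg_mem' := by
    rintro _ ⟨ξ, hξ, rfl⟩
    exact ⟨-ξ, by rw [boundary_neg, hξ, neg_zero], map_neg _ _⟩

/-- The tropical Jacobian `Ω(Γ)^* / Λ`, with its quotient topology. -/
abbrev Jacobian : Type _ := Γ.FormsDual ⧸ Γ.lattice

theorem boundary_single (e : E) :
    Γ.boundary (Pi.single e (1 : ℤ)) = Pi.single (Γ.tgt e) 1 - Pi.single (Γ.src e) 1 := by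
  funext w
  simp [boundary, Pi.single_apply, eq_comm]

theorem exists_path (v' w : V) :
    ∃ ξ : E → ℤ, Γ.boundary ξ = Pi.single w 1 - Pi.single v' 1 := by
  induction Γ.connected v' w with
  | rel a b h =>
    obtain ⟨e, rfl, rfl⟩ := h
    exact ⟨Pi.single e 1, Γ.boundary_single e⟩
  | refl a => exact ⟨0, by rw [boundary_zero, sub_self]⟩
  | symm a b _ ih =>
    obtain ⟨ξ, hξ⟩ := ih
    exact ⟨-ξ, by rw [boundary_neg, hξ, neg_sub]⟩
  | trans a b c _ _ ih1 ih2 =>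
    obtain ⟨ξ, hξ⟩ := ih1
    obtain ⟨η, hη⟩ := ih2
    exact ⟨ξ + η, by rw [boundary_add, hξ, hη]; abel⟩

/-- The `1`-chain of a chosen path from the basepoint `v'` to the vertex `w`. -/
def path (v' w : V) : E → ℤ := (Γ.exists_path v' w).choose

theorem boundary_path (v' w : V) :
    Γ.boundary (Γ.path v' w) = Pi.single w 1 - Pi.single v' 1 :=
  (Γ.exists_path v' w).choose_spec

/-- Integration along a path from `v'` to a point. -/
def pathIntegral (v' : V) : Γ.Point → Γ.FormsDual
  | Sum.inl w => Γ.intIntegral (Γ.path v' w)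
  | Sum.inr ⟨e, t⟩ =>
      Γ.intIntegral (Γ.path v' (Γ.src e)) + ((t : ℝ) / Γ.len e) • Γ.integral (Pi.single e 1)

/-- The tropical Abel–Jacobi map on divisors, with basepoint `v'`. -/
def divisorAbelJacobi (v' : V) : Γ.Divisor →+ Γ.Jacobian :=
  Finsupp.liftAddHom fun p =>
    zmultiplesHom Γ.Jacobian ((Γ.pathIntegral v' p : Γ.FormsDual) : Γ.Jacobian)

/-- A piecewise linear function on `[0, L]` whose slope at `0` is zero and which has no breakpoints
vanishes if it vanishes at `0`. -/
theorem eq_zero_of_slopes {ψ : ℝ → ℝ} {L : ℝ} (r l : ℝ → ℤ) (h0 : ψ 0 = 0) (hr0 : r 0 = 0)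
    (hr : ∀ t ∈ Set.Ico 0 L, HasRightSlope ψ t (r t))
    (hl : ∀ t ∈ Set.Ioc 0 L, HasLeftSlope ψ t (l t))
    (hrl : ∀ t ∈ Set.Ioo 0 L, r t + l t = 0) : ∀ x ∈ Set.Icc 0 L, ψ x = 0 := by
  by_cases hL : 0 ≤ L
  swap
  · exact fun x hx => absurd (hx.1.trans hx.2) hL
  set A : Set ℝ := {x | x ∈ Set.Icc 0 L ∧ ∀ y ∈ Set.Icc 0 x, ψ y = 0} with hA
  have hA0 : (0 : ℝ) ∈ A := by
    refine ⟨⟨le_rfl, hL⟩, fun y hy => ?_⟩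
    rw [le_antisymm hy.2 hy.1, h0]
  have hbdd : BddAbove A := ⟨L, fun x hx => hx.1.2⟩
  set c := sSup A with hc
  have hc0 : 0 ≤ c := le_csSup hbdd hA0
  have hcL : c ≤ L := csSup_le ⟨0, hA0⟩ fun x hx => hx.1.2
  have hlt : ∀ y, 0 ≤ y → y < c → ψ y = 0 := by
    intro y hy hyc
    obtain ⟨x, hx, hyx⟩ := exists_lt_of_lt_csSup ⟨0, hA0⟩ hyc
    exact hx.2 y ⟨hy, hyx.le⟩
  have hleft : 0 < c → ψ c = 0 ∧ l c = 0 := by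
    intro hcpos
    obtain ⟨ε, hε, h⟩ := hl c ⟨hcpos, hcL⟩
    set u := min ε c with hu
    have hupos : 0 < u := lt_min hε hcpos
    have e1 := h u ⟨hupos.le, min_le_left _ _⟩
    have e2 := h (u / 2) ⟨by positivity, by linarith [min_le_left ε c]⟩
    rw [hlt _ (by linarith [min_le_right ε c]) (by linarith)] at e1
    rw [hlt _ (by linarith [min_le_right ε c]) (by linarith)] at e2
    have e3 : (l c : ℝ) * u = 0 := by linarith
    have e4 : (l c : ℝ) = 0 := (mul_eq_zero.1 e3).resolve_right hupos.ne'
    refine ⟨by rw [e3] at e1; linarith, by exact_mod_cast e4⟩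
  have hψc : ψ c = 0 := by
    rcases hc0.eq_or_lt with h | h
    · rw [← h, h0]
    · exact (hleft h).1
  have hle : ∀ y, 0 ≤ y → y ≤ c → ψ y = 0 := by
    intro y hy hyc
    rcases hyc.eq_or_lt with h | h
    · rw [h, hψc]
    · exact hlt y hy h
  suffices hcc : c = L by
    intro x hx
    exact hle x hx.1 (hcc ▸ hx.2)
  by_contra hne
  have hcltL : c < L := lt_of_le_of_ne hcL hne
  have hrc : r c = 0 := by
    rcases hc0.eq_or_lt with h | h
    · rw [← h, hr0]
    · have := hrl c ⟨h, hcltL⟩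
      rw [(hleft h).2] at this
      simpa using this
  obtain ⟨ε, hε, h⟩ := hr c ⟨hc0, hcltL⟩
  have hmem : c + min ε (L - c) ∈ A := by
    have hpos : 0 < min ε (L - c) := lt_min hε (by linarith)
    refine ⟨⟨by linarith, by linarith [min_le_right ε (L - c)]⟩, fun y hy => ?_⟩
    rcases le_total y c with hyc | hyc
    · exact hle y hy.1 hyc
    · have := h (y - c) ⟨by linarith, by linarith [hy.2, min_le_left ε (L - c)]⟩
      rw [hrc, hψc] at this
      simpa using this
  have := le_csSup hbdd hmem
  have hpos : 0 < min ε (L - c) := lt_min hε (by linarith)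
  linarith

theorem HasRightSlope.sum {ι : Type*} (T : Finset ι) {φ : ι → ℝ → ℝ} {t : ℝ} {a : ι → ℤ}
    (h : ∀ i ∈ T, HasRightSlope (φ i) t (a i)) :
    HasRightSlope (fun x => ∑ i ∈ T, φ i x) t (∑ i ∈ T, a i) := by
  classical
  induction T using Finset.induction_on with
  | empty => exact ⟨1, one_pos, by simp⟩
  | insert i T hi ih =>
    simp only [Finset.sum_insert hi]
    exact (h i (Finset.mem_insert_self _ _)).add
      (ih fun j hj => h j (Finset.mem_insert_of_mem hj))

theorem HasLeftSlope.sum {ι : Type*} (T : Finset ι) {φ : ι → ℝ → ℝ} {t : ℝ} {a : ι → ℤ}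
    (h : ∀ i ∈ T, HasLeftSlope (φ i) t (a i)) :
    HasLeftSlope (fun x => ∑ i ∈ T, φ i x) t (∑ i ∈ T, a i) := by
  classical
  induction T using Finset.induction_on with
  | empty => exact ⟨1, one_pos, by simp⟩
  | insert i T hi ih =>
    simp only [Finset.sum_insert hi]
    exact (h i (Finset.mem_insert_self _ _)).add
      (ih fun j hj => h j (Finset.mem_insert_of_mem hj))

theorem hasRightSlope_hinge (n : ℤ) (s t : ℝ) :
    HasRightSlope (fun x => -(n * max 0 (x - s))) t (if s ≤ t then -n else 0) := by
  split_ifs with h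
  · refine ⟨1, one_pos, fun u hu => ?_⟩
    simp only
    rw [max_eq_right (by linarith [hu.1]), max_eq_right (by linarith)]
    push_cast; ring
  · refine ⟨s - t, by linarith, fun u hu => ?_⟩
    simp only
    rw [max_eq_left (by linarith [hu.2]), max_eq_left (by linarith)]
    simp

theorem hasLeftSlope_hinge (n : ℤ) (s t : ℝ) :
    HasLeftSlope (fun x => -(n * max 0 (x - s))) t (if s < t then n else 0) := by
  split_ifs with h
  · refine ⟨t - s, by linarith, fun u hu => ?_⟩
    simp only
    rw [max_eq_right (by linarith [hu.2]), max_eq_right (by linarith)]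
    ring
  · refine ⟨1, one_pos, fun u hu => ?_⟩
    simp only
    rw [max_eq_left (by linarith [hu.1]), max_eq_left (by linarith)]
    simp

/-- Summation by parts for a piecewise linear function on `[0, L]`. -/
theorem sum_jumps {φ : ℝ → ℝ} {L : ℝ} (hL : 0 < L) (r l : ℝ → ℤ)
    (hr : ∀ t ∈ Set.Ico 0 L, HasRightSlope φ t (r t))
    (hl : ∀ t ∈ Set.Ioc 0 L, HasLeftSlope φ t (l t))
    (T : Finset ℝ) (hT : ∀ t ∈ T, t ∈ Set.Ioo 0 L)
    (hj : ∀ t ∈ Set.Ioo 0 L, t ∉ T → r t + l t = 0) :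
    ∑ t ∈ T, (r t + l t) = -r 0 - l L ∧
      ∑ t ∈ T, ((r t + l t : ℤ) : ℝ) * t = -(l L) * L - (φ L - φ 0) := by
  set ψ : ℝ → ℝ := fun x =>
    (φ x + -(φ 0 + r 0 * x)) + ∑ s ∈ T, -(((r s + l s : ℤ) : ℝ) * max 0 (x - s)) with hψ
  set r' : ℝ → ℤ := fun t =>
    (r t + -r 0) + ∑ s ∈ T, (if s ≤ t then -(r s + l s) else 0) with hr'
  set l' : ℝ → ℤ := fun t =>
    (l t + r 0) + ∑ s ∈ T, (if s < t then (r s + l s) else 0) with hl'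
  have R : ∀ t ∈ Set.Ico 0 L, HasRightSlope ψ t (r' t) := fun t ht =>
    ((hr t ht).add ⟨1, one_pos, fun u _ => by push_cast; ring⟩).add
      (HasRightSlope.sum T fun s _ => hasRightSlope_hinge _ _ _)
  have Lf : ∀ t ∈ Set.Ioc 0 L, HasLeftSlope ψ t (l' t) := fun t ht =>
    ((hl t ht).add ⟨1, one_pos, fun u _ => by ring⟩).add
      (HasLeftSlope.sum T fun s _ => hasLeftSlope_hinge _ _ _)
  have hpos : ∀ s ∈ T, ¬ s ≤ 0 := fun s hs => not_le.2 (hT s hs).1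
  have hltL : ∀ s ∈ T, s < L := fun s hs => (hT s hs).2
  have hzero : ∀ x ∈ Set.Icc 0 L, ψ x = 0 := by
    refine eq_zero_of_slopes r' l' ?_ ?_ R Lf ?_
    · simp only [hψ]
      rw [Finset.sum_eq_zero]
      · simp
      · intro s hs
        rw [max_eq_left (by linarith [(hT s hs).1])]; simp
    · simp only [hr']
      rw [Finset.sum_eq_zero]
      · simp
      · intro s hs
        rw [if_neg (hpos s hs)]
    · intro t ht
      have key : (∑ s ∈ T, (if s ≤ t then -(r s + l s) else 0)) +
          ∑ s ∈ T, (if s < t then (r s + l s) else 0) = if t ∈ T then -(r t + l t) else 0 := by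
        rw [← Finset.sum_add_distrib, ← Finset.sum_ite_eq T t fun s => -(r s + l s)]
        refine Finset.sum_congr rfl fun s _ => ?_
        rcases lt_trichotomy s t with h | h | h
        · rw [if_pos h.le, if_pos h, if_neg h.ne']; ring
        · subst h; simp
        · rw [if_neg (not_le.2 h), if_neg (not_lt.2 h.le), if_neg h.ne]; ring
      simp only [hr', hl']
      by_cases htT : t ∈ T
      · rw [if_pos htT] at key; linarith
      · rw [if_neg htT] at key; linarith [hj t ht htT]
  have hlL : l' L = 0 := by
    obtain ⟨ε, hε, h⟩ := Lf L ⟨hL, le_rfl⟩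
    have hu : 0 < min ε L := lt_min hε hL
    have e1 := h (min ε L) ⟨hu.le, min_le_left _ _⟩
    rw [hzero _ ⟨by linarith [min_le_right ε L], by linarith⟩, hzero L ⟨hL.le, le_rfl⟩] at e1
    have e3 : (l' L : ℝ) * min ε L = 0 := by linarith
    have e4 : (l' L : ℝ) = 0 := (mul_eq_zero.1 e3).resolve_right hu.ne'
    exact_mod_cast e4
  have s1 : ∑ t ∈ T, (r t + l t) = -r 0 - l L := by
    simp only [hl'] at hlL
    rw [Finset.sum_congr rfl fun s hs => if_pos (hltL s hs)] at hlL
    linarith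
  refine ⟨s1, ?_⟩
  have s1' : ∑ t ∈ T, ((r t + l t : ℤ) : ℝ) = -r 0 - l L := by
    rw [← Int.cast_sum, s1]; push_cast; ring
  have h2 := hzero L ⟨hL.le, le_rfl⟩
  simp only [hψ] at h2
  rw [Finset.sum_congr rfl fun s hs =>
    show -(((r s + l s : ℤ) : ℝ) * max 0 (L - s)) =
      ((r s + l s : ℤ) : ℝ) * s - ((r s + l s : ℤ) : ℝ) * L by
      rw [max_eq_right (by linarith [hltL s hs])]; ring,
    Finset.sum_sub_distrib, ← Finset.sum_mul, s1'] at h2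
  linarith

/-- The interior points of `e` in the support of `D`. -/
def interiorSupport (D : Γ.Divisor) (e : E) : Finset (Set.Ioo (0 : ℝ) (Γ.len e)) :=
  D.support.preimage (fun t => Sum.inr ⟨e, t⟩) (by
    intro a _ b _ h
    simpa using h)

theorem mem_interiorSupport (D : Γ.Divisor) (e : E) (t : Set.Ioo (0 : ℝ) (Γ.len e)) :
    t ∈ Γ.interiorSupport D e ↔ D (Sum.inr ⟨e, t⟩) ≠ 0 := by
  exact Finset.mem_preimage.trans Finsupp.mem_support_iff

theorem sum_points {M : Type*} [AddCommGroup M] (D : Γ.Divisor) (g : Γ.Point → M) :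
    D.sum (fun p n => n • g p) = ∑ w, D (Sum.inl w) • g (Sum.inl w) +
      ∑ e, ∑ t ∈ Γ.interiorSupport D e, D (Sum.inr ⟨e, t⟩) • g (Sum.inr ⟨e, t⟩) := by
  have hsub : D.support ⊆ Finset.univ.disjSum (Finset.univ.sigma (Γ.interiorSupport D)) := by
    rintro (w | ⟨e, t⟩) h
    · simp
    · rw [Finset.inr_mem_disjSum, Finset.mem_sigma, mem_interiorSupport]
      exact ⟨Finset.mem_univ _, Finsupp.mem_support_iff.1 h⟩
  rw [Finsupp.sum_of_support_subset D hsub (fun p n => n • g p) (fun p _ => zero_smul ℤ (g p)),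
    Finset.sum_disjSum,
    Finset.sum_sigma]

theorem sum_ends {M : Type*} [AddCommGroup M] (a b : E → ℤ) (G : V → M) :
    ∑ w, (∑ e with Γ.src e = w, a e + ∑ e with Γ.tgt e = w, b e) • G w =
      ∑ e, (a e • G (Γ.src e) + b e • G (Γ.tgt e)) := by
  simp only [add_smul, Finset.sum_add_distrib, Finset.sum_smul]
  congr 1
  · rw [← Finset.sum_fiberwise Finset.univ Γ.src]
    refine Finset.sum_congr rfl fun w _ => Finset.sum_congr rfl fun e he => ?_
    rw [(Finset.mem_filter.1 he).2]
  · rw [← Finset.sum_fiberwise Finset.univ Γ.tgt]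
    refine Finset.sum_congr rfl fun w _ => Finset.sum_congr rfl fun e he => ?_
    rw [(Finset.mem_filter.1 he).2]

theorem intIntegral_single (e : E) :
    Γ.intIntegral (Pi.single e 1) = Γ.integral (Pi.single e 1) := by
  change Γ.integral _ = _
  congr 1
  funext e'
  by_cases h : e' = e
  · subst h; simp
  · simp [h]

theorem integral_single_apply (e : E) (ω : Γ.harmonicForms) :
    Γ.evalForm ω (Γ.integral (Pi.single e 1)) = Γ.len e * (ω : E → ℝ) e := by
  rw [integral_apply, Finset.sum_eq_single e]
  · simp
  · intro b _ hb
    simp [hb]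
  · simp

theorem sum_exact (f : V → ℝ) (ω : Γ.harmonicForms) :
    ∑ e, (f (Γ.tgt e) - f (Γ.src e)) * (ω : E → ℝ) e = 0 := by
  have h : ∀ w, Γ.boundary (ω : E → ℝ) w = 0 := fun w => congrFun ω.2 w
  have h2 : ∑ w, f w * Γ.boundary (ω : E → ℝ) w = 0 := by simp [h]
  have fib : ∀ a : E → V, ∑ w, ∑ e with a e = w, f w * (ω : E → ℝ) e =
      ∑ e, f (a e) * (ω : E → ℝ) e := by
    intro a
    rw [← Finset.sum_fiberwise Finset.univ a]
    refine Finset.sum_congr rfl fun w _ => Finset.sum_congr rfl fun e he => ?_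
    rw [(Finset.mem_filter.1 he).2]
  simp only [boundary, mul_sub, Finset.sum_sub_distrib, Finset.mul_sum, fib] at h2
  simpa only [sub_mul, Finset.sum_sub_distrib] using h2

/-- The Abel–Jacobi map vanishes on principal divisors. -/
theorem divisorAbelJacobi_principal (v' : V) (D : Γ.Divisor) (hD : D ∈ Γ.principal) :
    Γ.divisorAbelJacobi v' D = 0 := by
  obtain ⟨f, r, l, hr, hl, hin, hvert⟩ := hD
  have e1 : Γ.divisorAbelJacobi v' D =
      ((D.sum fun p n => n • Γ.pathIntegral v' p : Γ.FormsDual) : Γ.Jacobian) := by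
    rw [divisorAbelJacobi, Finsupp.liftAddHom_apply, Finsupp.sum, Finsupp.sum,
      QuotientAddGroup.mk_sum]
    rfl
  rw [e1, QuotientAddGroup.eq_zero_iff]
  refine ⟨∑ w, D (Sum.inl w) • Γ.path v' w +
    ∑ e, ((-r e 0 - l e (Γ.len e)) • Γ.path v' (Γ.src e) - l e (Γ.len e) • Pi.single e 1),
    ?_, ?_⟩
  · let B : (E → ℤ) →+ (V → ℤ) := AddMonoidHom.mk' Γ.boundary Γ.boundary_add
    change B _ = 0
    have hp : ∀ w, B (Γ.path v' w) = Pi.single w 1 - Pi.single v' 1 := Γ.boundary_path v'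
    have hs : ∀ e, B (Pi.single e 1) = Pi.single (Γ.tgt e) 1 - Pi.single (Γ.src e) 1 :=
      Γ.boundary_single
    simp only [map_add, map_sum, map_sub, map_zsmul, hp, hs, hvert]
    have hends := Γ.sum_ends (fun e => r e 0) (fun e => l e (Γ.len e))
      (fun w => (Pi.single w 1 - Pi.single v' 1 : V → ℤ))
    refine (congrArg (· + _) hends).trans ?_
    rw [← Finset.sum_add_distrib]
    refine Finset.sum_eq_zero fun e _ => ?_
    module
  · have hsrc : ∀ e, Γ.edgePoint e 0 = Sum.inl (Γ.src e) := fun e => by simp [edgePoint]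
    have htgt : ∀ e, Γ.edgePoint e (Γ.len e) = Sum.inl (Γ.tgt e) := fun e => by
      simp [edgePoint, Γ.len_pos e]
    have hsum : ∀ e, ∑ t ∈ Γ.interiorSupport D e,
        D (Sum.inr ⟨e, t⟩) • Γ.pathIntegral v' (Sum.inr ⟨e, t⟩) =
        (-r e 0 - l e (Γ.len e)) • Γ.intIntegral (Γ.path v' (Γ.src e)) -
          l e (Γ.len e) • Γ.integral (Pi.single e 1) -
          ((f (Sum.inl (Γ.tgt e)) - f (Sum.inl (Γ.src e))) / Γ.len e) •
            Γ.integral (Pi.single e 1) := by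
      intro e
      have hL := Γ.len_pos e
      obtain ⟨k1, k2⟩ := sum_jumps hL (r e) (l e) (hr e) (hl e)
        ((Γ.interiorSupport D e).map (Function.Embedding.subtype _))
        (by
          intro t ht
          obtain ⟨t, _, rfl⟩ := Finset.mem_map.1 ht
          exact t.2)
        (by
          intro t ht hn
          rw [← hin e ⟨t, ht⟩]
          by_contra hne
          refine hn (Finset.mem_map.2 ⟨⟨t, ht⟩, ?_, rfl⟩)
          exact (Γ.mem_interiorSupport D e _).2 hne)
      simp only [Finset.sum_map, Function.Embedding.subtype_apply, ← hin, hsrc, htgt] at k1 k2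
      have step : ∀ t : Set.Ioo (0 : ℝ) (Γ.len e),
          D (Sum.inr ⟨e, t⟩) • Γ.pathIntegral v' (Sum.inr ⟨e, t⟩) =
            D (Sum.inr ⟨e, t⟩) • Γ.intIntegral (Γ.path v' (Γ.src e)) +
              ((D (Sum.inr ⟨e, t⟩) : ℝ) * t / Γ.len e) • Γ.integral (Pi.single e 1) := by
        intro t
        rw [pathIntegral, smul_add, mul_div_assoc, mul_smul, Int.cast_smul_eq_zsmul]
      rw [Finset.sum_congr rfl fun t _ => step t, Finset.sum_add_distrib, ← Finset.sum_smul,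
        ← Finset.sum_smul, ← Finset.sum_div, k1, k2,
        ← Int.cast_smul_eq_zsmul ℝ (l e (Γ.len e)) (Γ.integral _), sub_sub, ← add_smul,
        sub_eq_add_neg _ ((_ : ℝ) • Γ.integral _), ← neg_smul]
      congr 2
      field_simp
      ring
    rw [Γ.sum_points D (Γ.pathIntegral v')]
    simp only [hsum, map_add, map_sum, map_sub, map_zsmul, intIntegral_single,
      Finset.sum_sub_distrib]
    have hz : ∑ e, ((f (Sum.inl (Γ.tgt e)) - f (Sum.inl (Γ.src e))) / Γ.len e) •
        Γ.integral (Pi.single e 1) = 0 := by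
      refine Γ.formsDual_ext fun ω => ?_
      have hx := Γ.sum_exact (fun w => f (Sum.inl w)) ω
      simp only [map_sum, map_smul, smul_eq_mul, integral_single_apply, map_zero]
      refine Eq.trans (Finset.sum_congr rfl fun e _ => ?_) hx
      have := (Γ.len_pos e).ne'
      field_simp
    simp only [hz, sub_zero, pathIntegral]

/-- The degree `n` part of the tropical Abel–Jacobi map, `Pic^n(Γ) → Ω(Γ)^* / Λ`. -/
def abelJacobi (v' : V) (n : ℤ) (x : Γ.Pic n) : Γ.Jacobian :=
  QuotientAddGroup.lift Γ.principal (Γ.divisorAbelJacobi v')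
    (fun D hD => Γ.divisorAbelJacobi_principal v' D hD) x.1

/-- The topology of `Pic^n(Γ)`, from its identification with the real torus `Ω(Γ)^* / Λ`. -/
@[reducible]
def picTopology (v' : V) (n : ℤ) : TopologicalSpace (Γ.Pic n) :=
  TopologicalSpace.induced (Γ.abelJacobi v' n) inferInstance

/-! ### The Namikawa decompositions -/

/-- The total degree of a sheaf, or of a divisor on the metric graph, of type `(S, d)`. -/
def typeDegree (S : Finset E) (d : V → ℤ) : ℤ := ∑ w, d w + (S.card : ℤ)

/-- The set of classes in `Pic^n(Γ)` of divisors of type `(S, d)`. -/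
def openCell (n : ℤ) (S : Finset E) (d : V → ℤ) : Set (Γ.Pic n) :=
  {x | ∃ D : Γ.Divisor, Γ.IsOfType S d D ∧ (D : Γ.Divisor ⧸ Γ.principal) = x.1}

/-- The closed cell `θ_{S,d}` of `Pic^n(Γ)`. -/
def cell (v' : V) (n : ℤ) (S : Finset E) (d : V → ℤ) : Set (Γ.Pic n) :=
  @closure _ (Γ.picTopology v' n) (Γ.openCell n S d)

/-- The decomposition of `Pic^n(Γ)` into polystable types. -/
def polystableCells (H : V → ℕ) (v' : V) (n : ℤ) : Set (Set (Γ.Pic n)) :=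
  {c | ∃ (S : Finset E) (d : V → ℤ),
    typeDegree S d = n ∧ Γ.IsPolystable H S d ∧ c = Γ.cell v' n S d}

/-- The decomposition of `Pic^n(Γ)` into `v`-quasistable types. -/
def quasistableCells (H : V → ℕ) (v v' : V) (n : ℤ) : Set (Set (Γ.Pic n)) :=
  {c | ∃ (S : Finset E) (d : V → ℤ),
    typeDegree S d = n ∧ Γ.IsQuasistable H v S d ∧ c = Γ.cell v' n S d}

/-- The integral `1`-chains joining the basepoint to the divisor `d + ∑_{e ∈ S} (source of e)`, the
chains from which the zonotopes lifting `θ_{S,d}` start. -/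
def IsLiftChain (v' : V) (S : Finset E) (d : V → ℤ) (ξ : E → ℤ) : Prop :=
  Γ.boundary ξ = d + ∑ e ∈ S, Pi.single (Γ.src e) 1 - typeDegree S d • Pi.single v' 1

/-- The zonotope `{∫_ξ + ∑_{e ∈ S} (t_e / len e) ∫_e : 0 ≤ t_e ≤ len e}`. -/
def zonotope (S : Finset E) (ξ : E → ℤ) : Set Γ.FormsDual :=
  {x | ∃ t : E → ℝ, (∀ e ∈ S, 0 ≤ t e ∧ t e ≤ Γ.len e) ∧
    x = Γ.intIntegral ξ + ∑ e ∈ S, (t e / Γ.len e) • Γ.integral (Pi.single e 1)}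

/-- The periodic decomposition of `Ω(Γ)^*` into polystable types. -/
def polystablePolytopes (H : V → ℕ) (v' : V) (n : ℤ) : Set (Set Γ.FormsDual) :=
  {c | ∃ (S : Finset E) (d : V → ℤ) (ξ : E → ℤ),
    typeDegree S d = n ∧ Γ.IsPolystable H S d ∧ Γ.IsLiftChain v' S d ξ ∧ c = Γ.zonotope S ξ}

/-- The periodic decomposition of `Ω(Γ)^*` into `v`-quasistable types. -/
def quasistablePolytopes (H : V → ℕ) (v v' : V) (n : ℤ) : Set (Set Γ.FormsDual) :=
  {c | ∃ (S : Finset E) (d : V → ℤ) (ξ : E → ℤ),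
    typeDegree S d = n ∧ Γ.IsQuasistable H v S d ∧ Γ.IsLiftChain v' S d ξ ∧ c = Γ.zonotope S ξ}

end

end MetricGraph

/-- The family of cells `A` refines the family of cells `B`: both cover the whole space, every cell of
`A` lies in a cell of `B`, and every cell of `B` is the union of the cells of `A` that it contains. -/
def IsRefinement {X : Type*} (A B : Set (Set X)) : Prop :=
  ⋃₀ A = Set.univ ∧ ⋃₀ B = Set.univ ∧ (∀ a ∈ A, ∃ b ∈ B, a ⊆ b) ∧
    ∀ b ∈ B, b = ⋃₀ {a | a ∈ A ∧ a ⊆ b}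

/-! A type `(S, d)` of degree `n` together with a lift `ξ` amounts to a cube `ξ + [0, 1]^S` of the
standard cubical subdivision of `ℝ^E`; the multidegree is recovered from `∂ξ` (`chainDegree`).
Integration maps the cube onto its zonotope and kills the chains with coefficients `(f (tgt e) - f
(src e)) / len e` (`integral_grad`), called gradients below. So a point of `Ω(Γ)^*` represented by a
chain `x` is also represented by every `x + grad f`, and the freedom in `f` is used to reach a cube
with the desired stability. Stability is measured by the slack `μ H(W) - χ(F_W)`: semistable means
that all slacks are nonnegative, and the tight subcurves, those of slack zero, are the ones that
destabilize equally. By `slack_chainDegree` the slack of `Y` is a term depending only on `Y` plus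
local terms on the edges leaving or entering `Y`.

Three facts carry the theorem. Semistable cells cover (`exists_semistable`): a suitable convex
piecewise linear function of `f` attains its minimum, and its one-sided derivative in the direction
`-1_Y` is the slack of `Y` for the smallest cube containing `x + grad f`; hence at a minimum all
slacks are nonnegative.

Each semistable cube is a face of a polystable one (`exists_polystable`,
`exists_polystable_zonotope`): a maximal chain of tight subcurves is a Jordan–Hölder filtration, and
passing to the graded sheaf frees the coordinates of the edges between different pieces.

Each point of a polystable zonotope lies in the zonotope of a `v`-quasistable face
(`exists_quasistable_face`): among the `f` with `f v = 0` that keep `x + grad f` in the cube, take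
one with `∑ w, f w` maximal. Slacks do not decrease on passing to a face. A proper tight `Y`
containing `v` would already be tight for the polystable type, so every edge between `Y` and its
complement lies in `S`; tightness leaves these coordinates room to move, and `f` could be raised off
`Y`, against maximality.

These facts give the refinement of the periodic decompositions. It descends to `Pic^n` because a
closed cell is the preimage of the image of any one of its lifts in the torus (`mem_cell_iff`), the
lattice being closed and zonotopes compact. -/

namespace MetricGraph

set_option linter.unusedSectionVars false

noncomputable section

variable {V E : Type*} [Fintype V] [Fintype E] [DecidableEq V] [DecidableEq E]
variable (Γ : MetricGraph V E)
variable {H : V → ℕ} {μ : ℚ} {S S' : Finset E} {d d' : V → ℤ}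

open Filter Topology

/-! ### Slack of a subcurve -/

/-- For `μ` the slope of `F`, this is `μ * H(W) - χ(F_W)` for the sheaf of type `(S, d)` on `Y`;
see `slack_eq`. -/
def slack (H : V → ℕ) (μ : ℚ) (S : Finset E) (d : V → ℤ) (Y W : Finset V) : ℚ :=
  ∑ w ∈ W, (μ * H w - 1 + Γ.genus w - d w) +
    ∑ e, if e ∉ S ∧ Γ.src e ∈ Y ∧ Γ.tgt e ∈ Y ∧ (Γ.src e ∈ W ∨ Γ.tgt e ∈ W) then (1 : ℚ) else 0

theorem slack_empty (Y : Finset V) : Γ.slack H μ S d Y ∅ = 0 := by simp [slack]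

theorem slack_eq {Y W : Finset V} (h : W ⊆ Y) :
    Γ.slack H μ S d Y W = μ * ∑ w ∈ W, (H w : ℚ) -
      ((Γ.subDegree S d Y W + 1 - Γ.arithGenus W : ℤ) : ℚ) := by
  have hc : ∀ T : Finset E, (T.card : ℚ) = ∑ e, if e ∈ T then (1 : ℚ) else 0 := by
    intro T; simp
  -- Edge by edge: an inner edge of `W` in `S` cancels between the degree and the genus, and an edge
  -- of `Y` outside `S` that touches `W` counts `-1`, through the genus if it is inner and through
  -- the degree if it is cut.
  have key : ((S ∩ Γ.innerEdges W).card : ℚ) - ((Γ.cutEdges W (Y \ W) \ S).card : ℚ) -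
      ((Γ.innerEdges W).card : ℚ) = - ∑ e, if e ∉ S ∧ Γ.src e ∈ Y ∧ Γ.tgt e ∈ Y ∧
        (Γ.src e ∈ W ∨ Γ.tgt e ∈ W) then (1 : ℚ) else 0 := by
    rw [hc, hc, hc, ← Finset.sum_sub_distrib, ← Finset.sum_sub_distrib, ← Finset.sum_neg_distrib]
    refine Finset.sum_congr rfl fun e _ => ?_
    simp only [Finset.mem_inter, Finset.mem_sdiff, innerEdges, cutEdges, Finset.mem_filter,
      Finset.mem_univ, true_and]
    have h1 := @h (Γ.src e)
    have h2 := @h (Γ.tgt e)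
    by_cases a : e ∈ S <;> by_cases b : Γ.src e ∈ W <;> by_cases c : Γ.tgt e ∈ W <;>
      by_cases b' : Γ.src e ∈ Y <;> by_cases c' : Γ.tgt e ∈ Y <;> simp_all
  simp only [slack, subDegree, arithGenus, Finset.sum_sub_distrib, Finset.sum_add_distrib,
    ← Finset.mul_sum]
  push_cast
  simp only [Finset.sum_const, nsmul_eq_mul, mul_one]
  linarith

theorem slope_eq_sub (hH : ∀ w, 0 < H w) {Y W : Finset V} (h : W ⊆ Y) (hW : W.Nonempty) :
    0 < ∑ w ∈ W, (H w : ℚ) ∧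
      Γ.slope H S d Y W = μ - Γ.slack H μ S d Y W / ∑ w ∈ W, (H w : ℚ) := by
  have hpos : 0 < ∑ w ∈ W, (H w : ℚ) :=
    Finset.sum_pos (fun w _ => by exact_mod_cast hH w) hW
  refine ⟨hpos, ?_⟩
  rw [Γ.slack_eq h, slope]
  field_simp
  ring

/-! ### Stability as a sign condition on the slack -/

theorem slope_le_iff (hH : ∀ w, 0 < H w) {Y W : Finset V} (h : W ⊆ Y) (hW : W.Nonempty) :
    Γ.slope H S d Y W ≤ μ ↔ 0 ≤ Γ.slack H μ S d Y W := by
  obtain ⟨hpos, heq⟩ := Γ.slope_eq_sub (μ := μ) (S := S) (d := d) hH h hW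
  rw [heq, sub_le_self_iff, le_div_iff₀ hpos, zero_mul]

theorem slope_lt_iff (hH : ∀ w, 0 < H w) {Y W : Finset V} (h : W ⊆ Y) (hW : W.Nonempty) :
    Γ.slope H S d Y W < μ ↔ 0 < Γ.slack H μ S d Y W := by
  obtain ⟨hpos, heq⟩ := Γ.slope_eq_sub (μ := μ) (S := S) (d := d) hH h hW
  rw [heq, sub_lt_self_iff, lt_div_iff₀ hpos, zero_mul]

theorem slope_eq_iff (hH : ∀ w, 0 < H w) {Y W : Finset V} (h : W ⊆ Y) (hW : W.Nonempty) :
    Γ.slope H S d Y W = μ ↔ Γ.slack H μ S d Y W = 0 := by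
  obtain ⟨hpos, heq⟩ := Γ.slope_eq_sub (μ := μ) (S := S) (d := d) hH h hW
  rw [heq, sub_eq_self, div_eq_zero_iff, or_iff_left hpos.ne']

/-- The slope of sheaves of degree `n`. -/
def totalSlope (H : V → ℕ) (n : ℤ) : ℚ :=
  ((n + 1 - Γ.arithGenus Finset.univ : ℤ) : ℚ) / ∑ w, (H w : ℚ)

theorem slope_univ {n : ℤ} (h : typeDegree S d = n) :
    Γ.slope H S d Finset.univ Finset.univ = Γ.totalSlope H n := by
  rw [slope, totalSlope, ← h]
  simp [subDegree, typeDegree, innerEdges, cutEdges]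

theorem slack_univ (hH : ∀ w, 0 < H w) {n : ℤ} (h : typeDegree S d = n) :
    Γ.slack H (Γ.totalSlope H n) S d Finset.univ Finset.univ = 0 := by
  rcases (Finset.univ : Finset V).eq_empty_or_nonempty with h0 | h0
  · rw [h0, slack_empty]
  · exact (Γ.slope_eq_iff hH subset_rfl h0).1 (Γ.slope_univ h)

theorem isSemistable_iff (hH : ∀ w, 0 < H w) {n : ℤ} (h : typeDegree S d = n) :
    Γ.IsSemistable H S d ↔
      ∀ Y, 0 ≤ Γ.slack H (Γ.totalSlope H n) S d Finset.univ Y := by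
  rw [IsSemistable, Γ.slope_univ h]
  constructor
  · intro hs Y
    rcases Y.eq_empty_or_nonempty with rfl | hY
    · rw [slack_empty]
    · by_cases hu : Y = Finset.univ
      · rw [hu, Γ.slack_univ hH h]
      · exact (Γ.slope_le_iff hH (Finset.subset_univ _) hY).1 (hs Y hY hu)
  · intro hs Y hY _
    exact (Γ.slope_le_iff hH (Finset.subset_univ _) hY).2 (hs Y)

theorem isQuasistable_iff (hH : ∀ w, 0 < H w) (v : V) {n : ℤ} (h : typeDegree S d = n) :
    Γ.IsQuasistable H v S d ↔
      (∀ Y, 0 ≤ Γ.slack H (Γ.totalSlope H n) S d Finset.univ Y) ∧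
        ∀ Y, Y ≠ Finset.univ → Γ.slack H (Γ.totalSlope H n) S d Finset.univ Y = 0 → v ∉ Y := by
  rw [IsQuasistable, Γ.isSemistable_iff hH h, Γ.slope_univ h]
  refine and_congr_right fun _ => forall_congr' fun Y => ?_
  constructor
  · intro hY hu h0 hv
    exact hY ⟨v, hv⟩ hu ((Γ.slope_eq_iff hH (Finset.subset_univ _) ⟨v, hv⟩).2 h0) hv
  · intro hY hne hu h0
    exact hY hu ((Γ.slope_eq_iff hH (Finset.subset_univ _) hne).1 h0)

/-! ### Slack of quotients and of direct sums -/

/-- The slack of a subsheaf of the quotient `F_Z' / F_Z`. -/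
theorem slack_quotient {Z Z' W : Finset V} (hZ : Z ⊆ Z') (hW : W ⊆ Z' \ Z) :
    Γ.slack H μ S (Γ.subMultidegree S d Z') (Z' \ Z) W =
      Γ.slack H μ S d Finset.univ (Z ∪ W) - Γ.slack H μ S d Finset.univ Z := by
  have hdisj : Disjoint Z W :=
    Finset.disjoint_left.2 fun w hw hw' => (Finset.mem_sdiff.1 (hW hw')).2 hw
  have hsum : ∑ w ∈ W, ((Γ.cutEdges {w} Z'ᶜ \ S).card : ℚ) =
      ∑ e, if e ∉ S ∧ ((Γ.src e ∈ W ∧ Γ.tgt e ∉ Z') ∨ (Γ.src e ∉ Z' ∧ Γ.tgt e ∈ W))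
        then (1 : ℚ) else 0 := by
    have hc : ∀ T : Finset E, (T.card : ℚ) = ∑ e, if e ∈ T then (1 : ℚ) else 0 := by
      intro T; simp
    simp only [hc]
    rw [Finset.sum_comm]
    refine Finset.sum_congr rfl fun e _ => ?_
    have h1 : Γ.src e ∈ W → Γ.src e ∈ Z' := fun h => (Finset.mem_sdiff.1 (hW h)).1
    have h2 : Γ.tgt e ∈ W → Γ.tgt e ∈ Z' := fun h => (Finset.mem_sdiff.1 (hW h)).1
    simp only [cutEdges, Finset.mem_sdiff, Finset.mem_filter, Finset.mem_univ, true_and,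
      Finset.mem_singleton, Finset.mem_compl]
    by_cases a : e ∈ S
    · simp [a]
    · by_cases b : Γ.src e ∈ Z' <;> by_cases c : Γ.tgt e ∈ Z' <;> simp_all
      intro x hx
      exact ⟨by rintro rfl; exact h1 hx, by rintro rfl; exact h2 hx⟩
  -- The edges outside `S` that touch `W` but not `Z` are of two kinds: those inside `Z' \ Z`, which
  -- are edges of the quotient, and those leaving `Z'`, which are recorded by the drop in
  -- multidegree.
  have hedge : (∑ e, if e ∉ S ∧ Γ.src e ∈ Z' \ Z ∧ Γ.tgt e ∈ Z' \ Z ∧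
        (Γ.src e ∈ W ∨ Γ.tgt e ∈ W) then (1 : ℚ) else 0) +
      (∑ e, if e ∉ S ∧ ((Γ.src e ∈ W ∧ Γ.tgt e ∉ Z') ∨ (Γ.src e ∉ Z' ∧ Γ.tgt e ∈ W))
        then (1 : ℚ) else 0) =
      (∑ e, if e ∉ S ∧ (Γ.src e ∈ Z ∪ W ∨ Γ.tgt e ∈ Z ∪ W) then (1 : ℚ) else 0) -
      ∑ e, if e ∉ S ∧ (Γ.src e ∈ Z ∨ Γ.tgt e ∈ Z) then (1 : ℚ) else 0 := by
    rw [← Finset.sum_add_distrib, ← Finset.sum_sub_distrib]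
    refine Finset.sum_congr rfl fun e _ => ?_
    have h1 := @hW (Γ.src e)
    have h2 := @hW (Γ.tgt e)
    have h3 := @hZ (Γ.src e)
    have h4 := @hZ (Γ.tgt e)
    simp only [Finset.mem_sdiff, Finset.mem_union] at h1 h2 ⊢
    by_cases a : e ∈ S
    · simp [a]
    by_cases b : Γ.src e ∈ Z <;> by_cases c : Γ.tgt e ∈ Z <;>
      by_cases b' : Γ.src e ∈ Z' <;> by_cases c' : Γ.tgt e ∈ Z' <;>
      by_cases b'' : Γ.src e ∈ W <;> by_cases c'' : Γ.tgt e ∈ W <;> simp_all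
  simp only [slack, subMultidegree, Finset.mem_univ, true_and, Finset.sum_union hdisj]
  have : ∑ w ∈ W, (μ * H w - 1 + Γ.genus w - ((d w - (Γ.cutEdges {w} Z'ᶜ \ S).card : ℤ) : ℚ)) =
      ∑ w ∈ W, (μ * H w - 1 + Γ.genus w - d w) +
        ∑ w ∈ W, ((Γ.cutEdges {w} Z'ᶜ \ S).card : ℚ) := by
    rw [← Finset.sum_add_distrib]
    refine Finset.sum_congr rfl fun w _ => ?_
    push_cast; ring
  rw [this, hsum]
  linarith

/-- No edge outside `S` joins `A` to its complement. -/
def IsSplit (S : Finset E) (A : Finset V) : Prop :=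
  ∀ e ∉ S, (Γ.src e ∈ A ↔ Γ.tgt e ∈ A)

/-- The slack is additive for a sheaf that splits as a direct sum. -/
theorem slack_split {Z Z' Y : Finset V} (hZ : Z ⊆ Z') (h : Γ.IsSplit S Z) (h' : Γ.IsSplit S Z') :
    Γ.slack H μ S d Finset.univ (Y ∩ Z') =
      Γ.slack H μ S d Finset.univ (Y ∩ Z) + Γ.slack H μ S d (Z' \ Z) (Y ∩ (Z' \ Z)) := by
  have hdisj : Disjoint (Y ∩ Z) (Y ∩ (Z' \ Z)) :=
    Finset.disjoint_left.2 fun w hw hw' => by simp_all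
  have hun : Y ∩ Z' = (Y ∩ Z) ∪ (Y ∩ (Z' \ Z)) := by
    rw [← Finset.inter_union_distrib_left, Finset.union_sdiff_of_subset hZ]
  -- By the two splittings, an edge outside `S` lies entirely in `Z`, in `Z' \ Z` or outside `Z'`.
  have hedge : (∑ e, if e ∉ S ∧ (Γ.src e ∈ Y ∩ Z' ∨ Γ.tgt e ∈ Y ∩ Z') then (1 : ℚ) else 0) =
      (∑ e, if e ∉ S ∧ (Γ.src e ∈ Y ∩ Z ∨ Γ.tgt e ∈ Y ∩ Z) then (1 : ℚ) else 0) +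
      ∑ e, if e ∉ S ∧ Γ.src e ∈ Z' \ Z ∧ Γ.tgt e ∈ Z' \ Z ∧
        (Γ.src e ∈ Y ∩ (Z' \ Z) ∨ Γ.tgt e ∈ Y ∩ (Z' \ Z)) then (1 : ℚ) else 0 := by
    rw [← Finset.sum_add_distrib]
    refine Finset.sum_congr rfl fun e _ => ?_
    by_cases a : e ∈ S
    · simp [a]
    have h1 := h e a
    have h2 := h' e a
    have h3 := @hZ (Γ.src e)
    simp only [Finset.mem_sdiff, Finset.mem_inter]
    by_cases b : Γ.src e ∈ Z <;> by_cases c : Γ.src e ∈ Z' <;> simp_all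
  simp only [slack, Finset.mem_univ, true_and]
  rw [hedge]
  conv_lhs => rw [hun, Finset.sum_union hdisj]
  ring

theorem slack_congr {Y W : Finset V} (hW : W ⊆ Y) (hd : ∀ w ∈ Y, d w = d' w)
    (hS : ∀ e, Γ.src e ∈ Y → Γ.tgt e ∈ Y → (e ∈ S ↔ e ∈ S')) :
    Γ.slack H μ S d Y W = Γ.slack H μ S' d' Y W := by
  unfold slack
  congr 1
  · exact Finset.sum_congr rfl fun w hw => by rw [hd w (hW hw)]
  · refine Finset.sum_congr rfl fun e _ => if_congr ?_ rfl rfl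
    have := hS e
    tauto

/-! ### Jordan–Hölder filtrations -/

theorem isStableOn_iff (hH : ∀ w, 0 < H w) {Y : Finset V} (h : Γ.slope H S d Y Y = μ) :
    Γ.IsStableOn H S d Y ↔ ∀ W : Finset V, W.Nonempty → W ⊂ Y → 0 < Γ.slack H μ S d Y W := by
  rw [IsStableOn, h]
  exact forall_congr' fun W => forall_congr' fun hW => forall_congr' fun hWY =>
    Γ.slope_lt_iff hH hWY.subset hW

/-- Applied with `T` the tight subcurves. The chain grows upwards from `A`, each time by a minimal
member of `T` strictly above the current one, so nothing in `T` fits between consecutive terms. -/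
theorem exists_maximal_chain (T : Finset V → Prop) (hT : T Finset.univ) (A : Finset V) (hA : T A) :
    ∃ (k : ℕ) (Z : ℕ → Finset V), Z 0 = A ∧ Z k = Finset.univ ∧ (∀ j < k, Z j ⊂ Z (j + 1)) ∧
      (∀ j ≤ k, T (Z j)) ∧ ∀ j < k, ∀ B, Z j ⊂ B → B ⊂ Z (j + 1) → ¬ T B := by
  induction A using WellFoundedGT.induction with
  | ind A ih =>
    by_cases hu : A = Finset.univ
    · refine ⟨0, fun _ => A, rfl, hu, by simp, ?_, by simp⟩
      intro j _
      exact hA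
    obtain ⟨B, ⟨hB, hAB⟩, hmin⟩ := wellFounded_lt.has_min {B | T B ∧ A ⊂ B}
      ⟨Finset.univ, hT, Finset.ssubset_univ_iff.2 hu⟩
    obtain ⟨k, Z, h0, hk, hst, hTZ, hmax⟩ := ih B hAB hB
    refine ⟨k + 1, fun j => Nat.casesOn j A Z, rfl, hk, ?_, ?_, ?_⟩
    · rintro (_ | j) hj
      · simpa [h0] using hAB
      · exact hst j (by omega)
    · rintro (_ | j) hj
      · exact hA
      · exact hTZ j (by omega)
    · rintro (_ | j) hj C hC hC' hTC
      · simp only [h0] at hC'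
        exact hmin C ⟨hTC, hC⟩ hC'
      · exact hmax j (by omega) C hC hC' hTC

theorem chain_mono {k : ℕ} {Z : ℕ → Finset V} (h : ∀ j < k, Z j ⊂ Z (j + 1)) {i j : ℕ}
    (hij : i ≤ j) (hj : j ≤ k) : Z i ⊆ Z j := by
  induction j, hij using Nat.le_induction with
  | base => rfl
  | succ j _ ih => exact (ih (by omega)).trans (h j (by omega)).subset

/-- Each vertex lies in exactly one piece `Z (j + 1) \ Z j`; recording this `j` turns statements
about the filtration into inequalities of natural numbers. -/
theorem exists_index {k : ℕ} {Z : ℕ → Finset V} (h0 : Z 0 = ∅) (hk : Z k = Finset.univ)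
    (h : ∀ j < k, Z j ⊂ Z (j + 1)) :
    ∃ idx : V → ℕ, (∀ w, idx w < k) ∧ ∀ w, ∀ i ≤ k, w ∈ Z i ↔ idx w < i := by
  have key : ∀ w, ∀ i ≤ k, w ∈ Z i → ∃ j < i, w ∈ Z (j + 1) ∧ w ∉ Z j := by
    intro w i
    induction i with
    | zero => simp [h0]
    | succ i ih =>
      intro hi hw
      by_cases hw' : w ∈ Z i
      · obtain ⟨j, hj, hj'⟩ := ih (by omega) hw'
        exact ⟨j, by omega, hj'⟩
      · exact ⟨i, by omega, hw, hw'⟩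
  choose idx h1 h2 h3 using fun w => key w k le_rfl (hk ▸ Finset.mem_univ w)
  refine ⟨idx, h1, fun w i hi => ⟨fun hw => ?_, fun hw => ?_⟩⟩
  · by_contra hlt
    exact h3 w (chain_mono h (not_lt.1 hlt) (h1 w).le hw)
  · exact chain_mono h hw hi (h2 w)

/-- A direct sum of stable sheaves of the same slope is semistable, and its tight subcurves are
unions of pieces. -/
theorem slack_nonneg_of_split {k : ℕ} {Z : ℕ → Finset V} (h0 : Z 0 = ∅)
    (hm : ∀ j < k, Z j ⊆ Z (j + 1)) (hs : ∀ j ≤ k, Γ.IsSplit S (Z j))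
    (hp : ∀ j < k, ∀ W ⊆ Z (j + 1) \ Z j, 0 ≤ Γ.slack H μ S d (Z (j + 1) \ Z j) W ∧
      (Γ.slack H μ S d (Z (j + 1) \ Z j) W = 0 → W = ∅ ∨ W = Z (j + 1) \ Z j)) (Y : Finset V) :
    ∀ j ≤ k, 0 ≤ Γ.slack H μ S d Finset.univ (Y ∩ Z j) ∧
      (Γ.slack H μ S d Finset.univ (Y ∩ Z j) = 0 → Γ.IsSplit S (Y ∩ Z j)) := by
  intro j
  induction j with
  | zero =>
    intro _
    rw [h0, Finset.inter_empty, slack_empty]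
    exact ⟨le_rfl, fun _ e _ => by simp⟩
  | succ j ih =>
    intro hj
    obtain ⟨i1, i2⟩ := ih (by omega)
    obtain ⟨p1, p2⟩ := hp j (by omega) (Y ∩ (Z (j + 1) \ Z j)) Finset.inter_subset_right
    have s1 := hs j (by omega)
    have s2 := hs (j + 1) hj
    rw [Γ.slack_split (hm j (by omega)) s1 s2]
    refine ⟨add_nonneg i1 p1, fun h => ?_⟩
    have i2 := i2 (by linarith)
    intro e he
    have a := i2 e he
    have b := s1 e he
    have c := s2 e he
    rcases p2 (by linarith) with h | h <;>
    · rw [Finset.ext_iff] at h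
      have x := h (Γ.src e)
      have y := h (Γ.tgt e)
      simp only [Finset.mem_inter, Finset.mem_sdiff, Finset.notMem_empty] at a x y ⊢
      clear p2 p1 i1 h hp hs hm
      grind

theorem slack_pieces (hH : ∀ w, 0 < H w) {Y : Finset V} (hst : Γ.IsStableOn H S d Y)
    (hsl : Γ.slope H S d Y Y = μ) {W : Finset V} (hW : W ⊆ Y) :
    0 ≤ Γ.slack H μ S d Y W ∧ (Γ.slack H μ S d Y W = 0 → W = ∅ ∨ W = Y) := by
  rcases W.eq_empty_or_nonempty with rfl | hne
  · exact ⟨(Γ.slack_empty Y).ge, fun _ => Or.inl rfl⟩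
  rcases hW.eq_or_ssubset with rfl | hss
  · exact ⟨((Γ.slope_eq_iff hH hW hne).1 hsl).ge, fun _ => Or.inr rfl⟩
  · have := (Γ.isStableOn_iff hH hsl).1 hst W hne hss
    exact ⟨this.le, fun h => absurd h this.ne'⟩

/-- The sheaf is the direct sum of its stable pieces, so a tight subcurve contains or misses each
piece, and no edge outside `S` joins different pieces. -/
theorem IsPolystable.isSplit (hH : ∀ w, 0 < H w) {n : ℤ} (hn : typeDegree S d = n)
    (h : Γ.IsPolystable H S d) {Y : Finset V}
    (hY : Γ.slack H (Γ.totalSlope H n) S d Finset.univ Y = 0) : Γ.IsSplit S Y := by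
  obtain ⟨_, k, Z, hJ, hG⟩ := h
  have hs : ∀ j ≤ k, Γ.IsSplit S (Z j) := by
    intro j hj e he
    rcases hj.eq_or_lt with rfl | hj
    · simp [hJ.last]
    · have : ¬ ∃ j < k, e ∈ Γ.cutEdges (Z j) (Z j)ᶜ := fun h => he ((hG.1 e).2 (Or.inr h))
      push Not at this
      have := this j hj
      simp only [cutEdges, Finset.mem_filter, Finset.mem_univ, true_and, Finset.mem_compl] at this
      tauto
  have hp := Γ.slack_nonneg_of_split (H := H) (μ := Γ.totalSlope H n) (d := d) hJ.zero
    (fun j hj => (hJ.strict j hj).subset) hs (fun j hj W hW => by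
      have e := Γ.slack_congr (H := H) (μ := Γ.totalSlope H n) hW (hG.2 j hj)
        (S := S) (S' := S) (fun _ _ _ => Iff.rfl)
      rw [e]
      exact Γ.slack_pieces hH (hJ.stable j hj) ((hJ.slope_eq j hj).trans (Γ.slope_univ hn)) hW)
    Y k le_rfl
  rw [hJ.last, Finset.inter_univ] at hp
  exact hp.2 hY

theorem sum_boundary (ξ : E → ℤ) : ∑ w, Γ.boundary ξ w = 0 := by
  simp only [boundary, Finset.sum_sub_distrib, Finset.sum_fiberwise, sub_self]

theorem typeDegree_eq_sum (S : Finset E) (d : V → ℤ) :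
    typeDegree S d = ∑ w, (d + ∑ e ∈ S, Pi.single (Γ.src e) 1 : V → ℤ) w := by
  simp only [typeDegree, Pi.add_apply, Finset.sum_add_distrib, Finset.sum_apply]
  rw [Finset.sum_comm]
  simp

/-- The graded sheaf of a Jordan–Hölder filtration is polystable. The chain `τ` is the difference
of the lifts of the two cells. -/
theorem exists_polystable (hH : ∀ w, 0 < H w) {n : ℤ} (hn : typeDegree S d = n)
    (h : Γ.IsSemistable H S d) :
    ∃ (S' : Finset E) (d' : V → ℤ) (τ : E → ℤ), typeDegree S' d' = n ∧ Γ.IsPolystable H S' d' ∧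
      S ⊆ S' ∧ (∀ e, τ e = 0 ∨ e ∈ S' ∧ e ∉ S ∧ τ e = -1) ∧
      Γ.boundary τ + (d + ∑ e ∈ S, Pi.single (Γ.src e) 1) =
        d' + ∑ e ∈ S', Pi.single (Γ.src e) 1 := by
  rw [Γ.isSemistable_iff hH hn] at h
  set μ := Γ.totalSlope H n with hμ
  -- A maximal chain of tight subcurves. Tightness gives the quotients slope `μ`, and maximality
  -- will make them stable.
  obtain ⟨k, Z, h0, hk, hst, hT, hmax⟩ := exists_maximal_chain
    (fun Y => Γ.slack H μ S d Finset.univ Y = 0) (Γ.slack_univ hH hn) ∅ (Γ.slack_empty _)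
  obtain ⟨idx, hidx, hmem⟩ := exists_index h0 hk hst
  set S' : Finset E := Finset.univ.filter fun e => e ∈ S ∨ idx (Γ.src e) ≠ idx (Γ.tgt e) with hS'
  set d' : V → ℤ := fun w => Γ.subMultidegree S d (Z (idx w + 1)) w with hd'
  -- The graded sheaf loses one degree at the lower-index end of each newly freed edge, so the old
  -- divisor is the limit where the new interior point tends to that end. If this end is the source,
  -- the old coordinate is the lower end of the new unit interval; if it is the target, it is the
  -- upper end, and the new chain starts one unit lower.
  set τ : E → ℤ := fun e => if e ∉ S ∧ idx (Γ.tgt e) < idx (Γ.src e) then -1 else 0 with hτ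
  have hcut : ∀ e, ∀ j ≤ k, (e ∈ Γ.cutEdges (Z j) (Z j)ᶜ ↔
      (idx (Γ.src e) < j ∧ ¬ idx (Γ.tgt e) < j) ∨ (¬ idx (Γ.src e) < j ∧ idx (Γ.tgt e) < j)) := by
    intro e j hj
    simp only [cutEdges, Finset.mem_filter, Finset.mem_univ, true_and, Finset.mem_compl,
      hmem _ j hj]
  have hbd : Γ.boundary τ + (d + ∑ e ∈ S, Pi.single (Γ.src e) 1) =
        d' + ∑ e ∈ S', Pi.single (Γ.src e) 1 := by
    funext w
    have hc : ∀ T : Finset E, (T.card : ℤ) = ∑ e, if e ∈ T then (1 : ℤ) else 0 := by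
      intro T; simp
    have hsg : ∀ T : Finset E, (∑ e ∈ T, (Pi.single (Γ.src e) 1 : V → ℤ)) w =
        ∑ e, if e ∈ T ∧ Γ.src e = w then 1 else 0 := by
      intro T
      rw [Finset.sum_apply, ← Finset.sum_filter, ← Finset.sum_filter_add_sum_filter_not T
        (fun e => Γ.src e = w)]
      rw [Finset.sum_eq_zero (s := T.filter fun e => ¬ Γ.src e = w)
        (fun e he => Pi.single_eq_of_ne' (Finset.mem_filter.1 he).2 1), add_zero]
      refine Finset.sum_congr (by ext; simp) fun e he => ?_
      rw [← (Finset.mem_filter.1 he).2.2, Pi.single_eq_same]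
    simp only [Pi.add_apply, hsg, hd', subMultidegree, boundary, Finset.sum_filter]
    rw [hc]
    have : (∑ e, if Γ.tgt e = w then τ e else 0) - (∑ e, if Γ.src e = w then τ e else 0) +
        (∑ e, if e ∈ S ∧ Γ.src e = w then 1 else 0) +
        (∑ e, if e ∈ Γ.cutEdges {w} (Z (idx w + 1))ᶜ \ S then (1 : ℤ) else 0) =
        ∑ e, if e ∈ S' ∧ Γ.src e = w then 1 else 0 := by
      rw [← Finset.sum_sub_distrib, ← Finset.sum_add_distrib, ← Finset.sum_add_distrib]
      refine Finset.sum_congr rfl fun e _ => ?_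
      simp only [hτ, hS', cutEdges, Finset.mem_sdiff, Finset.mem_filter, Finset.mem_univ, true_and,
        Finset.mem_singleton, Finset.mem_compl, hmem _ _ (hidx w)]
      by_cases a : e ∈ S
      · simp [a]
      by_cases b : Γ.src e = w <;> by_cases c : Γ.tgt e = w
      · simp [a, b, c]
      · subst b
        rcases lt_trichotomy (idx (Γ.src e)) (idx (Γ.tgt e)) with x | x | x
        · simp [a, c, x, x.ne, not_lt_of_gt x]
        · simp [a, c, x]
        · simp [a, c, x, x.ne', x.le]
      · subst c
        rcases lt_trichotomy (idx (Γ.src e)) (idx (Γ.tgt e)) with x | x | x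
        · simp [a, b, x.le, not_lt_of_gt x]
        · simp [a, b, x]
        · simp [a, b, x]
      · simp [b, c]
    linarith
  have hn' : typeDegree S' d' = n := by
    rw [← hn, Γ.typeDegree_eq_sum, Γ.typeDegree_eq_sum, ← hbd]
    simp only [Pi.add_apply _ (d + _), Finset.sum_add_distrib, sum_boundary, zero_add]
  have hpiece : ∀ j < k, ∀ w ∈ Z (j + 1) \ Z j, idx w = j := by
    intro j hj w hw
    rw [Finset.mem_sdiff, hmem w _ hj, hmem w _ hj.le] at hw
    omega
  have hdeg : ∀ j < k, ∀ w ∈ Z (j + 1) \ Z j, d' w = Γ.subMultidegree S d (Z (j + 1)) w := by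
    intro j hj w hw
    rw [hd', ← hpiece j hj w hw]
  have hgr : ∀ e, e ∈ S' ↔ e ∈ S' ∨ ∃ j < k, e ∈ Γ.cutEdges (Z j) (Z j)ᶜ := by
    intro e
    refine ⟨Or.inl, ?_⟩
    rintro (he | ⟨j, hj, he⟩)
    · exact he
    · rw [hcut e j hj.le] at he
      rw [hS', Finset.mem_filter]
      exact ⟨Finset.mem_univ _, Or.inr (by omega)⟩
  -- All edges leaving `Z (j + 1)` now belong to `S'`, so taking the graded type a second time
  -- changes nothing.
  have hdeg' : ∀ j < k, ∀ w ∈ Z (j + 1) \ Z j, d' w = Γ.subMultidegree S' d' (Z (j + 1)) w := by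
    intro j hj w hw
    have : Γ.cutEdges {w} (Z (j + 1))ᶜ \ S' = ∅ := by
      refine Finset.eq_empty_of_forall_notMem fun e he => ?_
      have hw' := hpiece j hj w hw
      simp only [hS', cutEdges, Finset.mem_sdiff, Finset.mem_filter, Finset.mem_univ, true_and,
        Finset.mem_singleton, Finset.mem_compl, hmem _ _ hj] at he
      obtain ⟨⟨rfl, h2⟩ | ⟨h2, rfl⟩, h3⟩ := he <;> exact h3 (Or.inr (by omega))
    simp [subMultidegree, this]
  have hsl : ∀ j < k, ∀ W ⊆ Z (j + 1) \ Z j,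
      Γ.slack H μ S' d' (Z (j + 1) \ Z j) W = Γ.slack H μ S d Finset.univ (Z j ∪ W) := by
    intro j hj W hW
    rw [← Γ.slack_congr hW (fun w hw => (hdeg j hj w hw).symm) (S := S) fun e h1 h2 => ?_,
      Γ.slack_quotient (hst j hj).subset hW, hT j hj.le, sub_zero]
    rw [hS', Finset.mem_filter, hpiece j hj _ h1, hpiece j hj _ h2]
    simp
  have hpos : ∀ j < k, ∀ W ⊆ Z (j + 1) \ Z j, W.Nonempty → W ≠ Z (j + 1) \ Z j →
      0 < Γ.slack H μ S' d' (Z (j + 1) \ Z j) W := by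
    intro j hj W hW hne hne'
    rw [hsl j hj W hW]
    -- Slack zero would make `Z j ∪ W` a tight subcurve strictly between consecutive terms of the
    -- maximal chain.
    refine lt_of_le_of_ne (h _) (Ne.symm (hmax j hj _ ?_ ?_))
    · obtain ⟨w, hw⟩ := hne
      refine (Finset.ssubset_iff_of_subset Finset.subset_union_left).2
        ⟨w, Finset.mem_union_right _ hw, (Finset.mem_sdiff.1 (hW hw)).2⟩
    · obtain ⟨w, hw, hw'⟩ := Finset.exists_of_ssubset (hW.ssubset_of_ne hne')
      refine (Finset.ssubset_iff_of_subset (Finset.union_subset (hst j hj).subset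
        (hW.trans Finset.sdiff_subset))).2 ⟨w, (Finset.mem_sdiff.1 hw).1, ?_⟩
      rw [Finset.mem_union]
      exact fun hc => hc.elim (Finset.mem_sdiff.1 hw).2 hw'
  have htop : ∀ j < k, Γ.slack H μ S' d' (Z (j + 1) \ Z j) (Z (j + 1) \ Z j) = 0 := by
    intro j hj
    rw [hsl j hj _ subset_rfl, Finset.union_sdiff_of_subset (hst j hj).subset, hT (j + 1) hj]
  have hsub : ∀ j < k, ∀ W ⊆ Z (j + 1) \ Z j,
      Γ.slack H μ S' (Γ.subMultidegree S' d' (Z (j + 1))) (Z (j + 1) \ Z j) W =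
        Γ.slack H μ S' d' (Z (j + 1) \ Z j) W := fun j hj W hW =>
    (Γ.slack_congr hW (hdeg' j hj) (fun _ _ _ => Iff.rfl)).symm
  have hslope : ∀ j < k, Γ.slope H S' (Γ.subMultidegree S' d' (Z (j + 1))) (Z (j + 1) \ Z j)
      (Z (j + 1) \ Z j) = μ := by
    intro j hj
    have hne : (Z (j + 1) \ Z j).Nonempty := Finset.sdiff_nonempty.2 (hst j hj).2
    rw [Γ.slope_eq_iff hH subset_rfl hne, hsub j hj _ subset_rfl, htop j hj]
  refine ⟨S', d', τ, hn', ⟨?_, k, Z, ⟨h0, hk, hst, ?_, ?_⟩, hgr, hdeg'⟩, ?_, ?_, hbd⟩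
  · rw [Γ.isSemistable_iff hH hn']
    intro Y
    have := (Γ.slack_nonneg_of_split (H := H) (μ := μ) (d := d') h0
      (fun j hj => (hst j hj).subset) (S := S') (k := k) ?_ ?_ Y k le_rfl).1
    · rwa [hk, Finset.inter_univ] at this
    · intro j hj e he
      rw [hS', Finset.mem_filter] at he
      push Not at he
      rw [hmem _ j hj, hmem _ j hj, (he (Finset.mem_univ _)).2]
    · intro j hj W hW
      rcases W.eq_empty_or_nonempty with rfl | hne
      · exact ⟨(Γ.slack_empty _).ge, fun _ => Or.inl rfl⟩
      by_cases hWP : W = Z (j + 1) \ Z j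
      · subst hWP
        exact ⟨(htop j hj).ge, fun _ => Or.inr rfl⟩
      · have := hpos j hj W hW hne hWP
        exact ⟨this.le, fun h => absurd h this.ne'⟩
  · intro j hj
    rw [Γ.isStableOn_iff hH (hslope j hj)]
    intro W hne hss
    rw [hsub j hj W hss.subset]
    exact hpos j hj W hss.subset hne hss.ne
  · intro j hj
    rw [hslope j hj, Γ.slope_univ hn']
  · intro e he
    rw [hS', Finset.mem_filter]
    exact ⟨Finset.mem_univ _, Or.inl he⟩
  · intro e
    by_cases hc : e ∉ S ∧ idx (Γ.tgt e) < idx (Γ.src e)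
    · refine Or.inr ⟨?_, hc.1, if_pos hc⟩
      rw [hS', Finset.mem_filter]
      exact ⟨Finset.mem_univ _, Or.inr hc.2.ne'⟩
    · exact Or.inl (if_neg hc)

/-! ### Chains and zonotopes -/

theorem sum_boundary_on {R : Type*} [AddCommGroup R] (Y : Finset V) (ξ : E → R) :
    ∑ w ∈ Y, Γ.boundary ξ w =
      ∑ e, ((if Γ.tgt e ∈ Y then ξ e else 0) - if Γ.src e ∈ Y then ξ e else 0) := by
  have h : ∀ a : E → V, ∑ w ∈ Y, ∑ e with a e = w, ξ e = ∑ e, if a e ∈ Y then ξ e else 0 := by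
    intro a
    simp only [Finset.sum_filter]
    rw [Finset.sum_comm]
    exact Finset.sum_congr rfl fun e _ => by simp
  simp only [boundary, Finset.sum_sub_distrib, h]

/-- Connectedness: send the amount `κ w` along the chosen path from `v'` to each `w`. The
contributions at `v'` cancel because the total is zero. -/
theorem exists_boundary_eq (v' : V) {κ : V → ℝ} (h : ∑ w, κ w = 0) :
    ∃ y : E → ℝ, Γ.boundary y = κ := by
  refine ⟨fun e => ∑ w, κ w * Γ.path v' w e, ?_⟩
  have hb : ∀ w u, Γ.boundary (fun e => (Γ.path v' w e : ℝ)) u =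
      (Pi.single w 1 - Pi.single v' 1 : V → ℝ) u := by
    intro w u
    have := congrFun (Γ.boundary_path v' w) u
    have := congrArg (Int.cast : ℤ → ℝ) this
    simp only [boundary, Pi.sub_apply, Int.cast_sub, Int.cast_sum] at this ⊢
    rw [this]
    simp only [Pi.single_apply]
    push_cast
    rfl
  funext u
  have : Γ.boundary (fun e => ∑ w, κ w * (Γ.path v' w e : ℝ)) u =
      ∑ w, κ w * Γ.boundary (fun e => (Γ.path v' w e : ℝ)) u := by
    simp only [boundary, mul_sub, Finset.sum_sub_distrib, Finset.mul_sum]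
    rw [Finset.sum_comm, Finset.sum_comm (s := Finset.univ.filter fun e => Γ.src e = u)]
  rw [this]
  simp only [hb, Pi.sub_apply, mul_sub, Finset.sum_sub_distrib, ← Finset.sum_mul, h, zero_mul,
    sub_zero]
  simp [Pi.single_apply]

/-- Gradients pair to zero with harmonic forms; this is the freedom used to move a representing
chain without moving the point of `Ω(Γ)^*`. -/
theorem integral_grad (f : V → ℝ) :
    Γ.integral (fun e => (f (Γ.tgt e) - f (Γ.src e)) / Γ.len e) = 0 := by
  refine Γ.formsDual_ext fun ω => ?_
  rw [integral_apply, map_zero, ← Γ.sum_exact f ω]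
  refine Finset.sum_congr rfl fun e _ => ?_
  rw [div_mul_cancel₀ _ (Γ.len_pos e).ne']

theorem integral_eq_sum (x : E → ℝ) : Γ.integral x = ∑ e, x e • Γ.integral (Pi.single e 1) := by
  conv_lhs => rw [← Finset.univ_sum_single x]
  rw [map_sum]
  refine Finset.sum_congr rfl fun e _ => ?_
  rw [← map_smul, ← Pi.single_smul, smul_eq_mul, mul_one]

/-- The zonotope as the image of the cube `ξ + [0, 1]^S` under integration. The coordinate `x e` is
`ξ e + t e / len e` on `S`. -/
theorem mem_zonotope {ξ : E → ℤ} {p : Γ.FormsDual} :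
    p ∈ Γ.zonotope S ξ ↔ ∃ x : E → ℝ, (∀ e ∈ S, (ξ e : ℝ) ≤ x e ∧ x e ≤ ξ e + 1) ∧
      (∀ e ∉ S, x e = ξ e) ∧ Γ.integral x = p := by
  have key : ∀ x : E → ℝ, (∀ e ∉ S, x e = ξ e) →
      Γ.integral x = Γ.intIntegral ξ + ∑ e ∈ S, (x e - ξ e) • Γ.integral (Pi.single e 1) := by
    intro x hx
    change _ = Γ.integral (fun e => (ξ e : ℝ)) + _
    rw [Γ.integral_eq_sum x, Γ.integral_eq_sum (fun e => (ξ e : ℝ)),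
      Finset.sum_subset (Finset.subset_univ S), ← Finset.sum_add_distrib]
    · exact Finset.sum_congr rfl fun e _ => by rw [← add_smul, add_sub_cancel]
    · intro e _ he
      rw [hx e he, sub_self, zero_smul]
  constructor
  · rintro ⟨t, ht, rfl⟩
    refine ⟨fun e => if e ∈ S then ξ e + t e / Γ.len e else ξ e, ?_, ?_, ?_⟩
    · intro e he
      have hl := Γ.len_pos e
      simp only [he, if_true]
      exact ⟨le_add_of_nonneg_right (div_nonneg (ht e he).1 hl.le),
        by linarith [(div_le_one hl).2 (ht e he).2]⟩
    · intro e he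
      simp only [he, if_false]
    · rw [key _ fun e he => by simp only [he, if_false]]
      congr 1
      refine Finset.sum_congr rfl fun e he => ?_
      simp only [he, if_true, add_sub_cancel_left]
  · rintro ⟨x, hx, hx', rfl⟩
    refine ⟨fun e => (x e - ξ e) * Γ.len e, fun e he => ?_, ?_⟩
    · have hl := (Γ.len_pos e).le
      have := hx e he
      exact ⟨mul_nonneg (by linarith) hl, mul_le_of_le_one_left hl (by linarith)⟩
    · rw [key x hx']
      congr 1
      refine Finset.sum_congr rfl fun e _ => ?_
      rw [mul_div_cancel_right₀ _ (Γ.len_pos e).ne']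

/-- The cube `ξ + [0, 1]^S` is a face of the cube `ξ' + [0, 1]^S'`. -/
def IsCubeFace (S : Finset E) (ξ : E → ℤ) (S' : Finset E) (ξ' : E → ℤ) : Prop :=
  ∀ e, (e ∈ S → e ∈ S' ∧ ξ e = ξ' e) ∧ (e ∉ S → ξ e = ξ' e ∨ e ∈ S' ∧ ξ e = ξ' e + 1)

theorem zonotope_subset {ξ ξ' : E → ℤ} (h : IsCubeFace S ξ S' ξ') :
    Γ.zonotope S ξ ⊆ Γ.zonotope S' ξ' := by
  intro p hp
  obtain ⟨x, hx, hx', rfl⟩ := Γ.mem_zonotope.1 hp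
  refine Γ.mem_zonotope.2 ⟨x, fun e he => ?_, fun e he => ?_, rfl⟩
  · by_cases heS : e ∈ S
    · rw [← ((h e).1 heS).2]
      exact hx e heS
    · rw [hx' e heS]
      rcases (h e).2 heS with h1 | ⟨_, h1⟩ <;> rw [h1] <;> push_cast <;>
        constructor <;> linarith
  · have heS : e ∉ S := fun heS => he ((h e).1 heS).1
    rw [hx' e heS]
    rcases (h e).2 heS with h1 | ⟨h1, _⟩
    · rw [h1]
    · exact absurd h1 he

/-! ### Types as cubes, and their slack in terms of the chain -/

/-- The multidegree `d` such that the chain `ξ` is a lift of the type `(S, d)` of degree `n`. -/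
def chainDegree (v' : V) (n : ℤ) (S : Finset E) (ξ : E → ℤ) : V → ℤ :=
  Γ.boundary ξ - ∑ e ∈ S, Pi.single (Γ.src e) 1 + n • Pi.single v' 1

theorem typeDegree_chainDegree (v' : V) (n : ℤ) (S : Finset E) (ξ : E → ℤ) :
    typeDegree S (Γ.chainDegree v' n S ξ) = n := by
  rw [Γ.typeDegree_eq_sum, chainDegree]
  have : ∀ a b c : V → ℤ, a - b + c + b = a + c := fun a b c => by abel
  rw [this]
  simp [Finset.sum_add_distrib, sum_boundary, Pi.single_apply]

theorem isLiftChain_iff {v' : V} {n : ℤ} (hn : typeDegree S d = n) {ξ : E → ℤ} :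
    Γ.IsLiftChain v' S d ξ ↔ d = Γ.chainDegree v' n S ξ := by
  rw [IsLiftChain, hn, chainDegree]
  constructor <;> intro h
  · rw [h]; abel
  · rw [h]; abel

/-- The slack at a vertex, up to the contributions of the edges. -/
def vertexSlack (H : V → ℕ) (μ : ℚ) (v' : V) (n : ℤ) (w : V) : ℚ :=
  μ * H w - 1 + Γ.genus w - (if w = v' then n else 0 : ℤ) +
    ∑ e, if Γ.src e = w then (1 : ℚ) else 0

/-- The dependence on the cube is confined to the edges between `Y` and its complement: an edge
leaving `Y` contributes `ξ e`, an edge entering `Y` contributes `-ξ e`, plus one if it is outside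
`S`. Both covering arguments rest on this formula. -/
theorem slack_chainDegree (v' : V) (n : ℤ) (ξ : E → ℤ) (Y : Finset V) :
    Γ.slack H μ S (Γ.chainDegree v' n S ξ) Finset.univ Y =
      ∑ w ∈ Y, Γ.vertexSlack H μ v' n w +
        ∑ e, if Γ.src e ∈ Y then (if Γ.tgt e ∈ Y then 0 else (ξ e : ℚ))
          else if Γ.tgt e ∈ Y then (if e ∈ S then 0 else 1) - (ξ e : ℚ) else 0 := by
  have hd : ∑ w ∈ Y, (Γ.chainDegree v' n S ξ w : ℚ) =
      ∑ e, ((if Γ.tgt e ∈ Y then (ξ e : ℚ) else 0) - if Γ.src e ∈ Y then (ξ e : ℚ) else 0) -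
        (∑ e, if e ∈ S ∧ Γ.src e ∈ Y then 1 else 0) +
        ∑ w ∈ Y, ((if w = v' then n else 0 : ℤ) : ℚ) := by
    have h1 : ∑ w ∈ Y, (∑ e ∈ S, (Pi.single (Γ.src e) 1 : V → ℤ)) w =
        ∑ e, if e ∈ S ∧ Γ.src e ∈ Y then 1 else 0 := by
      simp only [Finset.sum_apply]
      rw [Finset.sum_comm, ← Finset.sum_subset (Finset.subset_univ S)]
      · refine Finset.sum_congr rfl fun e he => ?_
        simp [he, Pi.single_apply]
      · intro e _ he
        simp [he]
    have h2 := Γ.sum_boundary_on Y ξ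
    simp only [chainDegree, Pi.add_apply, Pi.sub_apply, Pi.smul_apply, ← Int.cast_sum]
    rw [Finset.sum_add_distrib, Finset.sum_sub_distrib, h1, h2]
    push_cast
    simp [Pi.single_apply]
  have hv : ∑ w ∈ Y, ∑ e, (if Γ.src e = w then (1 : ℚ) else 0) =
      ∑ e, if Γ.src e ∈ Y then (1 : ℚ) else 0 := by
    rw [Finset.sum_comm]
    exact Finset.sum_congr rfl fun e _ => by simp
  have hE : (∑ e, if e ∉ S ∧ (Γ.src e ∈ Y ∨ Γ.tgt e ∈ Y) then (1 : ℚ) else 0) -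
      ∑ e, ((if Γ.tgt e ∈ Y then (ξ e : ℚ) else 0) - if Γ.src e ∈ Y then (ξ e : ℚ) else 0) +
        (∑ e, if e ∈ S ∧ Γ.src e ∈ Y then 1 else 0) =
      (∑ e, if Γ.src e ∈ Y then (1 : ℚ) else 0) +
        ∑ e, if Γ.src e ∈ Y then (if Γ.tgt e ∈ Y then 0 else (ξ e : ℚ))
          else if Γ.tgt e ∈ Y then (if e ∈ S then 0 else 1) - (ξ e : ℚ) else 0 := by
    rw [← Finset.sum_sub_distrib, ← Finset.sum_add_distrib, ← Finset.sum_add_distrib]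
    refine Finset.sum_congr rfl fun e _ => ?_
    by_cases a : e ∈ S <;> by_cases b : Γ.src e ∈ Y <;> by_cases c : Γ.tgt e ∈ Y <;>
      simp [a, b, c, add_comm]
  simp only [slack, vertexSlack, Finset.mem_univ, true_and, Finset.sum_add_distrib,
    Finset.sum_sub_distrib, hv] at hd hE ⊢
  rw [hd]
  linarith

/-- The whole curve has slack zero and no cut edges. This is the condition for the vertex slacks to
be a boundary. -/
theorem sum_vertexSlack (hH : ∀ w, 0 < H w) (v' : V) (n : ℤ) :
    ∑ w, Γ.vertexSlack H (Γ.totalSlope H n) v' n w = 0 := by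
  have h := Γ.slack_univ hH (Γ.typeDegree_chainDegree v' n ∅ 0)
  rw [slack_chainDegree] at h
  simpa using h

/-- Every semistable cell is contained in a polystable one. -/
theorem exists_polystable_zonotope (hH : ∀ w, 0 < H w) {v' : V} {n : ℤ}
    (hn : typeDegree S d = n) (h : Γ.IsSemistable H S d) :
    ∃ S' d', typeDegree S' d' = n ∧ Γ.IsPolystable H S' d' ∧ ∀ ξ, Γ.IsLiftChain v' S d ξ →
      ∃ ξ', Γ.IsLiftChain v' S' d' ξ' ∧ Γ.zonotope S ξ ⊆ Γ.zonotope S' ξ' := by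
  obtain ⟨S', d', τ, hn', hps, hSS, hτ, hb⟩ := Γ.exists_polystable hH hn h
  refine ⟨S', d', hn', hps, fun ξ hξ => ⟨ξ + τ, ?_, Γ.zonotope_subset fun e => ⟨fun he => ?_,
    fun he => ?_⟩⟩⟩
  · rw [IsLiftChain, hn] at hξ
    rw [IsLiftChain, hn', boundary_add, hξ, ← hb]
    abel
  · rcases hτ e with h | h
    · exact ⟨hSS he, by simp [h]⟩
    · exact absurd he h.2.1
  · rcases hτ e with h | ⟨h1, _, h2⟩
    · exact Or.inl (by simp [h])
    · exact Or.inr ⟨h1, by simp [h2]⟩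

/-! ### Functions with bounded slopes -/

theorem exists_bound (B : E → ℝ) (u w : V) : ∃ C : ℝ, ∀ f : V → ℝ,
    (∀ e, |f (Γ.tgt e) - f (Γ.src e)| ≤ B e) → |f w - f u| ≤ C := by
  induction Γ.connected u w with
  | rel a b h =>
    obtain ⟨e, rfl, rfl⟩ := h
    exact ⟨B e, fun f hf => hf e⟩
  | refl a => exact ⟨0, fun f _ => by simp⟩
  | symm a b _ ih =>
    obtain ⟨C, hC⟩ := ih
    exact ⟨C, fun f hf => by rw [abs_sub_comm]; exact hC f hf⟩
  | trans a b c _ _ ih1 ih2 =>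
    obtain ⟨C, hC⟩ := ih1
    obtain ⟨D, hD⟩ := ih2
    exact ⟨D + C, fun f hf => (abs_sub_le _ (f b) _).trans (add_le_add (hD f hf) (hC f hf))⟩

/-- On a connected graph, bounds on the differences along edges and the normalization `f v = 0`
bound every value of `f`. -/
theorem isCompact_of_slopes_bounded (v : V) (B : E → ℝ) {K : Set (V → ℝ)} (hc : IsClosed K)
    (h : ∀ f ∈ K, f v = 0 ∧ ∀ e, |f (Γ.tgt e) - f (Γ.src e)| ≤ B e) : IsCompact K := by
  choose C hC using fun w => Γ.exists_bound B v w
  refine IsCompact.of_isClosed_subset (isCompact_univ_pi fun w => isCompact_Icc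
    (a := -C w) (b := C w)) hc fun f hf w _ => ?_
  have := hC w f (h f hf).2
  rw [(h f hf).1, sub_zero] at this
  exact abs_le.1 this

/-! ### Refining polystable cells -/

/-- Given a point of a polystable cell, represented by the chain `x`, move `x` within its cube by
the gradient of a function with `f v = 0` and `∑ w, f w` maximal. The face reached is
`v`-quasistable. -/
theorem exists_quasistable_face (hH : ∀ w, 0 < H w) (v v' : V) {n : ℤ}
    (hn : typeDegree S d = n) (h : Γ.IsPolystable H S d) {ξ : E → ℤ}
    (hξ : Γ.IsLiftChain v' S d ξ) {p : Γ.FormsDual} (hp : p ∈ Γ.zonotope S ξ) :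
    ∃ (S₁ : Finset E) (d₁ : V → ℤ) (ξ₁ : E → ℤ), typeDegree S₁ d₁ = n ∧
      Γ.IsQuasistable H v S₁ d₁ ∧ Γ.IsLiftChain v' S₁ d₁ ξ₁ ∧ p ∈ Γ.zonotope S₁ ξ₁ ∧
      Γ.zonotope S₁ ξ₁ ⊆ Γ.zonotope S ξ := by
  obtain ⟨x, hx, hx', rfl⟩ := Γ.mem_zonotope.1 hp
  let gr : (V → ℝ) → E → ℝ := fun f e => x e + (f (Γ.tgt e) - f (Γ.src e)) / Γ.len e
  have hgr : ∀ e, Continuous fun f => gr f e := fun e => by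
    simp only [gr]; fun_prop
  -- The functions whose gradient keeps `x` in its cube. Two points of the cube differ by at most
  -- one in each coordinate, which bounds the slopes of `f`.
  set K : Set (V → ℝ) := {f | f v = 0 ∧ (∀ e ∈ S, (ξ e : ℝ) ≤ gr f e ∧ gr f e ≤ ξ e + 1) ∧
    ∀ e ∉ S, gr f e = ξ e} with hK
  have hKc : IsClosed K := by
    have h1 : IsClosed {f : V → ℝ | f v = 0} := isClosed_eq (by fun_prop) continuous_const
    have h2 : IsClosed {f : V → ℝ | ∀ e ∈ S, (ξ e : ℝ) ≤ gr f e ∧ gr f e ≤ ξ e + 1} := by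
      simp only [Set.ofPred_forall]
      exact isClosed_iInter fun e => isClosed_iInter fun _ =>
        (isClosed_le continuous_const (hgr e)).inter (isClosed_le (hgr e) continuous_const)
    have h3 : IsClosed {f : V → ℝ | ∀ e ∉ S, gr f e = ξ e} := by
      simp only [Set.ofPred_forall]
      exact isClosed_iInter fun e => isClosed_iInter fun _ =>
        isClosed_eq (hgr e) continuous_const
    exact h1.inter (h2.inter h3)
  have hKcpt : IsCompact K := by
    refine Γ.isCompact_of_slopes_bounded v (fun e => Γ.len e) hKc fun f hf => ⟨hf.1, fun e => ?_⟩
    have hl := Γ.len_pos e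
    suffices |(f (Γ.tgt e) - f (Γ.src e)) / Γ.len e| ≤ 1 by
      rwa [abs_div, abs_of_pos hl, div_le_one hl] at this
    by_cases he : e ∈ S
    · have h1 := hf.2.1 e he
      have h2 := hx e he
      simp only [gr] at h1
      rw [abs_le]
      constructor <;> linarith
    · have h1 := hf.2.2 e he
      simp only [gr, hx' e he] at h1
      rw [add_eq_left.1 h1]
      simp
  have h0 : (0 : V → ℝ) ∈ K := by
    refine ⟨rfl, fun e he => ?_, fun e he => ?_⟩
    · simpa [gr] using hx e he
    · simpa [gr] using hx' e he
  obtain ⟨f, hfK, hfmax⟩ := hKcpt.exists_isMaxOn ⟨0, h0⟩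
    (f := fun f : V → ℝ => ∑ w, f w) (by fun_prop)
  set z : E → ℝ := gr f with hz
  -- The face `ξ₁ + [0, 1]^S₁` is the smallest cube containing `z`: integral coordinates are fixed,
  -- the others are free.
  set ξ₁ : E → ℤ := fun e => ⌊z e⌋ with hξ₁
  set S₁ : Finset E := Finset.univ.filter fun e => z e ≠ ⌊z e⌋ with hS₁
  have hmem : ∀ e, e ∈ S₁ ↔ z e ≠ ⌊z e⌋ := fun e => by simp [hS₁]
  have hface : IsCubeFace S₁ ξ₁ S ξ := by
    intro e
    rw [hmem]
    by_cases heS : e ∈ S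
    · have h1 := hfK.2.1 e heS
      have h2 : ξ e ≤ ⌊z e⌋ := Int.le_floor.2 h1.1
      have h3 : ⌊z e⌋ ≤ ξ e + 1 := by
        have := (Int.floor_le (z e)).trans h1.2
        exact_mod_cast this
      refine ⟨fun h => ⟨heS, ?_⟩, fun _ => ?_⟩
      · by_contra hne
        have h4 : ⌊z e⌋ = ξ e + 1 := by simp only [hξ₁] at hne; omega
        apply h
        have := Int.floor_le (z e)
        rw [h4] at this ⊢
        push_cast at this ⊢
        exact le_antisymm h1.2 this
      · simp only [hξ₁, heS, true_and]
        omega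
    · have h1 : z e = ξ e := hfK.2.2 e heS
      have h2 : ξ₁ e = ξ e := by simp [hξ₁, h1]
      exact ⟨fun h => absurd (by rw [h1, Int.floor_intCast]) h, fun _ => Or.inl h2⟩
  have hz₁ : ∀ e ∈ S₁, e ∈ S ∧ (ξ e : ℝ) < z e ∧ z e < ξ e + 1 := by
    intro e he
    obtain ⟨h1, h2⟩ := (hface e).1 he
    refine ⟨h1, ?_⟩
    rw [← h2]
    exact ⟨lt_of_le_of_ne (Int.floor_le _) (Ne.symm ((hmem e).1 he)), Int.lt_floor_add_one _⟩
  have hz₂ : ∀ e ∉ S₁, z e = ξ₁ e := fun e he => by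
    rw [hmem, not_not] at he
    exact he
  have hd := (Γ.isLiftChain_iff hn).1 hξ
  have hss := (Γ.isSemistable_iff hH hn).1 h.1
  have hn₁ := Γ.typeDegree_chainDegree v' n S₁ ξ₁
  set d₁ := Γ.chainDegree v' n S₁ ξ₁ with hd₁
  -- Passing to a face does not decrease any edge term. The term grows strictly exactly when an edge
  -- of `S` leaving `Y` is fixed at its upper end or one entering `Y` is fixed at its lower end.
  have hterm : ∀ (Y : Finset V) (e : E),
      (if Γ.src e ∈ Y then (if Γ.tgt e ∈ Y then 0 else (ξ e : ℚ))
          else if Γ.tgt e ∈ Y then (if e ∈ S then 0 else 1) - (ξ e : ℚ) else 0) ≤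
      (if Γ.src e ∈ Y then (if Γ.tgt e ∈ Y then 0 else (ξ₁ e : ℚ))
          else if Γ.tgt e ∈ Y then (if e ∈ S₁ then 0 else 1) - (ξ₁ e : ℚ) else 0) := by
    intro Y e
    obtain ⟨h1, h2⟩ := hface e
    by_cases a : e ∈ S₁
    · obtain ⟨h1, h3⟩ := h1 a
      simp [a, h1, h3]
    · rcases h2 a with h3 | ⟨heS, h3⟩
      · by_cases heS : e ∈ S <;> by_cases b : Γ.src e ∈ Y <;> by_cases c : Γ.tgt e ∈ Y <;>
          simp [a, b, c, heS, h3]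
      · by_cases b : Γ.src e ∈ Y <;> by_cases c : Γ.tgt e ∈ Y <;> simp [a, b, c, heS, h3]
  have hle : ∀ Y, Γ.slack H (Γ.totalSlope H n) S d Finset.univ Y ≤
      Γ.slack H (Γ.totalSlope H n) S₁ d₁ Finset.univ Y := by
    intro Y
    rw [hd, hd₁, slack_chainDegree, slack_chainDegree]
    exact add_le_add_right (Finset.sum_le_sum fun e _ => hterm Y e) _
  refine ⟨S₁, d₁, ξ₁, hn₁, ?_, (Γ.isLiftChain_iff hn₁).2 hd₁, ?_, Γ.zonotope_subset hface⟩
  swap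
  · refine Γ.mem_zonotope.2 ⟨z, fun e he => ?_, hz₂, ?_⟩
    · rw [((hface e).1 he).2]
      exact ⟨(hz₁ e he).2.1.le, (hz₁ e he).2.2.le⟩
    · have : z = x + fun e => (f (Γ.tgt e) - f (Γ.src e)) / Γ.len e := rfl
      rw [this, map_add, integral_grad, add_zero]
  rw [Γ.isQuasistable_iff hH v hn₁]
  refine ⟨fun Y => (hss Y).trans (hle Y), fun Y hY hY0 hv => ?_⟩
  have hsplit : Γ.IsSplit S Y := h.isSplit Γ hH hn (le_antisymm ((hle Y).trans hY0.le) (hss Y))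
  -- Both slacks vanish, so each of the termwise inequalities is an equality; this leaves room to
  -- increase the coordinates of edges leaving `Y` and to decrease those of edges entering `Y`.
  have hterm' := by
    have h1 : Γ.slack H (Γ.totalSlope H n) S d Finset.univ Y =
        Γ.slack H (Γ.totalSlope H n) S₁ d₁ Finset.univ Y :=
      le_antisymm (hle Y) (hY0.le.trans (hss Y))
    rw [hd, hd₁, slack_chainDegree, slack_chainDegree, add_right_inj] at h1
    exact (Finset.sum_eq_sum_iff_of_le fun e _ => hterm Y e).1 h1
  have hout : ∀ e ∈ S, Γ.src e ∈ Y → Γ.tgt e ∉ Y → z e < ξ e + 1 := by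
    intro e _ h1 h2
    by_cases he : e ∈ S₁
    · exact (hz₁ e he).2.2
    · have := hterm' e (Finset.mem_univ e)
      simp only [h1, h2, if_true, if_false, Int.cast_inj] at this
      rw [hz₂ e he, ← this]
      linarith
  have hin : ∀ e ∈ S, Γ.src e ∉ Y → Γ.tgt e ∈ Y → (ξ e : ℝ) < z e := by
    intro e heS h1 h2
    by_cases he : e ∈ S₁
    · exact (hz₁ e he).2.1
    · have := hterm' e (Finset.mem_univ e)
      simp only [h1, h2, he, heS, if_true, if_false] at this
      have h3 : ξ₁ e = ξ e + 1 := by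
        have : (ξ₁ e : ℚ) = ξ e + 1 := by linarith
        exact_mod_cast this
      rw [hz₂ e he, h3]
      push_cast
      linarith
  -- Raise `f` by `u` off `Y`. As `v ∈ Y` the normalization survives, only coordinates of edges
  -- between `Y` and its complement change, and these belong to `S` by `hsplit`.
  let g : ℝ → V → ℝ := fun u w => f w + if w ∈ Y then 0 else u
  have hcont : ∀ e, Tendsto (fun u => gr (g u) e) (𝓝[>] 0) (𝓝 (z e)) := by
    intro e
    have h1 : Continuous fun u => gr (g u) e := by
      refine (hgr e).comp (continuous_pi fun w => ?_)
      simp only [g]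
      split_ifs <;> fun_prop
    have h2 : gr (g 0) e = z e := by simp [g, hz]
    rw [← h2]
    exact (h1.tendsto 0).mono_left nhdsWithin_le_nhds
  have hev : ∀ᶠ u in 𝓝[>] (0 : ℝ), ∀ e ∈ S,
      (z e < ξ e + 1 → gr (g u) e < ξ e + 1) ∧ ((ξ e : ℝ) < z e → (ξ e : ℝ) < gr (g u) e) := by
    rw [Filter.eventually_all_finset]
    intro e _
    refine Filter.Eventually.and ?_ ?_
    · rw [Filter.eventually_imp_distrib_left]
      exact fun h => (hcont e).eventually (gt_mem_nhds h)
    · rw [Filter.eventually_imp_distrib_left]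
      exact fun h => (hcont e).eventually (lt_mem_nhds h)
  obtain ⟨u, hu, hu0⟩ := (hev.and self_mem_nhdsWithin).exists
  have hu0 : 0 < u := hu0
  have hsame : ∀ e, (Γ.src e ∈ Y ↔ Γ.tgt e ∈ Y) → gr (g u) e = z e := by
    intro e he
    simp only [gr, g, hz]
    by_cases hs : Γ.src e ∈ Y
    · simp [hs, he.1 hs]
    · simp [hs, mt he.2 hs]
  have hguK : g u ∈ K := by
    refine ⟨by simp [g, hv, hfK.1], fun e he => ?_, fun e he => ?_⟩
    · have hl := Γ.len_pos e
      have hfe := hfK.2.1 e he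
      by_cases hs : Γ.src e ∈ Y <;> by_cases ht : Γ.tgt e ∈ Y
      · rw [hsame e (by tauto)]; exact hfe
      · have hmono : z e ≤ gr (g u) e := by
          simp only [gr, g, hz, hs, ht, if_true, if_false]
          gcongr <;> linarith
        exact ⟨hfe.1.trans hmono, ((hu e he).1 (hout e he hs ht)).le⟩
      · have hmono : gr (g u) e ≤ z e := by
          simp only [gr, g, hz, hs, ht, if_true, if_false]
          gcongr <;> linarith
        exact ⟨((hu e he).2 (hin e he hs ht)).le, hmono.trans hfe.2⟩
      · rw [hsame e (by tauto)]; exact hfe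
    · rw [hsame e (hsplit e he)]
      exact hfK.2.2 e he
  have hmax := hfmax hguK
  simp only [Set.mem_ofPred_eq, g, Finset.sum_add_distrib] at hmax
  obtain ⟨w, hw⟩ : ∃ w, w ∉ Y := by
    by_contra hc
    push Not at hc
    exact hY (Finset.eq_univ_of_forall hc)
  have hpos : 0 < ∑ w, if w ∈ Y then 0 else u := by
    refine Finset.sum_pos' (fun w _ => by split_ifs <;> linarith) ⟨w, Finset.mem_univ w, ?_⟩
    simpa [hw] using hu0
  linarith

/-! ### Covering by semistable cells -/

/-- The piecewise linear convex function on `ℝ` with slope `m` on `[m, m + 1]`. -/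
def stairPrimitive (x : ℝ) : ℝ := (x ^ 2 - x + Int.fract x * (1 - Int.fract x)) / 2

theorem continuous_stairPrimitive : Continuous stairPrimitive := by
  have h : Continuous fun x : ℝ => Int.fract x * (1 - Int.fract x) :=
    ContinuousOn.comp_fract'' (f := fun r : ℝ => r * (1 - r)) (by fun_prop) (by simp)
  unfold stairPrimitive
  fun_prop

theorem le_stairPrimitive (x : ℝ) : (x ^ 2 - x) / 2 ≤ stairPrimitive x := by
  have h1 := Int.fract_nonneg x
  have h2 := (Int.fract_lt_one x).le
  have := mul_nonneg h1 (sub_nonneg.2 h2)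
  unfold stairPrimitive
  linarith

theorem stairPrimitive_eq (m : ℤ) {z : ℝ} (h1 : (m : ℝ) ≤ z) (h2 : z ≤ m + 1) :
    stairPrimitive z = m * z - m * (m + 1) / 2 := by
  rcases h2.eq_or_lt with rfl | h2
  · have : Int.fract ((m : ℝ) + 1) = 0 := by
      rw [Int.fract_add_one, Int.fract_intCast]
    rw [stairPrimitive, this]
    ring
  · have : Int.fract z = z - m := by
      rw [← Int.self_sub_floor, Int.floor_eq_iff.2 ⟨h1, h2⟩]
    rw [stairPrimitive, this]
    ring

theorem stairPrimitive_add (x : ℝ) :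
    ∀ᶠ u in 𝓝[>] (0 : ℝ), stairPrimitive (x + u) = stairPrimitive x + ⌊x⌋ * u := by
  have h : ∀ᶠ u in 𝓝[>] (0 : ℝ), u < ⌊x⌋ + 1 - x :=
    nhdsWithin_le_nhds (gt_mem_nhds (by linarith [Int.lt_floor_add_one x]))
  filter_upwards [h, self_mem_nhdsWithin] with u hu hu0
  have hu0 : 0 < u := hu0
  have := Int.floor_le x
  rw [stairPrimitive_eq ⌊x⌋ (by linarith) (by linarith), stairPrimitive_eq ⌊x⌋ this (by linarith)]
  ring

theorem stairPrimitive_sub (x : ℝ) :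
    ∀ᶠ u in 𝓝[>] (0 : ℝ), stairPrimitive (x - u) = stairPrimitive x - (⌈x⌉ - 1) * u := by
  have h : ∀ᶠ u in 𝓝[>] (0 : ℝ), u < x - (⌈x⌉ - 1) :=
    nhdsWithin_le_nhds (gt_mem_nhds (by linarith [Int.ceil_lt_add_one x]))
  filter_upwards [h, self_mem_nhdsWithin] with u hu hu0
  have hu0 : 0 < u := hu0
  have := Int.le_ceil x
  rw [stairPrimitive_eq (⌈x⌉ - 1) (by push_cast; linarith) (by push_cast; linarith),
    stairPrimitive_eq (z := x) (⌈x⌉ - 1) (by push_cast; linarith) (by push_cast; linarith)]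
  push_cast
  ring

/-- The growth of `stairPrimitive` is quadratic and beats the linear term, so sublevel sets have
bounded slopes and, once normalized at `v`, are compact. -/
theorem exists_minimizer (v : V) (p y : E → ℝ) : ∃ f : V → ℝ, ∀ g : V → ℝ,
    ∑ e, Γ.len e * (stairPrimitive (p e + (f (Γ.tgt e) - f (Γ.src e)) / Γ.len e) -
      y e * (p e + (f (Γ.tgt e) - f (Γ.src e)) / Γ.len e)) ≤
    ∑ e, Γ.len e * (stairPrimitive (p e + (g (Γ.tgt e) - g (Γ.src e)) / Γ.len e) -
      y e * (p e + (g (Γ.tgt e) - g (Γ.src e)) / Γ.len e)) := by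
  obtain ⟨Ψ, hΨ⟩ : ∃ Ψ : (V → ℝ) → ℝ, Ψ = fun f =>
    ∑ e, Γ.len e * (stairPrimitive (p e + (f (Γ.tgt e) - f (Γ.src e)) / Γ.len e) -
      y e * (p e + (f (Γ.tgt e) - f (Γ.src e)) / Γ.len e)) := ⟨_, rfl⟩
  have hcont : Continuous Ψ := by
    rw [hΨ]
    refine continuous_finsetSum _ fun e _ => continuous_const.mul (Continuous.sub ?_ ?_)
    · exact continuous_stairPrimitive.comp (by fun_prop)
    · fun_prop
  set K : Set (V → ℝ) := {f | f v = 0 ∧ Ψ f ≤ Ψ 0} with hK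
  have hKc : IsClosed K :=
    (isClosed_eq (by fun_prop) continuous_const).inter (isClosed_le hcont continuous_const)
  -- Completing the square: `(z ^ 2 - z) / 2 - y * z = ((z - a) ^ 2 - a ^ 2) / 2`.
  set a : E → ℝ := fun e => 1 / 2 + y e with ha
  set M : ℝ := 2 * (Ψ 0 + ∑ e, Γ.len e * (a e ^ 2 / 2)) with hM
  have hbound : ∀ f, Ψ f ≤ Ψ 0 → ∀ e,
      (p e + (f (Γ.tgt e) - f (Γ.src e)) / Γ.len e - a e) ^ 2 ≤ M / Γ.len e := by
    intro f hf e
    set z : E → ℝ := fun e => p e + (f (Γ.tgt e) - f (Γ.src e)) / Γ.len e with hz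
    have h1 : ∀ e, Γ.len e * ((z e - a e) ^ 2 / 2) ≤
        Γ.len e * (stairPrimitive (z e) - y e * z e) + Γ.len e * (a e ^ 2 / 2) := by
      intro e
      rw [← mul_add]
      refine mul_le_mul_of_nonneg_left ?_ (Γ.len_pos e).le
      have := le_stairPrimitive (z e)
      simp only [ha]
      linarith
    have h2 : Γ.len e * ((z e - a e) ^ 2 / 2) ≤ ∑ e, Γ.len e * ((z e - a e) ^ 2 / 2) :=
      Finset.single_le_sum (f := fun e => Γ.len e * ((z e - a e) ^ 2 / 2))
        (fun e _ => mul_nonneg (Γ.len_pos e).le (by positivity)) (Finset.mem_univ e)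
    have h3 := h2.trans (Finset.sum_le_sum fun e _ => h1 e)
    rw [Finset.sum_add_distrib] at h3
    have h4 : ∑ e, Γ.len e * (stairPrimitive (z e) - y e * z e) ≤ Ψ 0 := by
      rwa [hΨ] at hf ⊢
    rw [le_div_iff₀ (Γ.len_pos e), hM]
    linarith
  have hKcpt : IsCompact K := by
    refine Γ.isCompact_of_slopes_bounded v
      (fun e => Γ.len e * (√(M / Γ.len e) + |a e - p e|)) hKc fun f hf => ⟨hf.1, fun e => ?_⟩
    have hl := Γ.len_pos e
    have h1 := Real.abs_le_sqrt (hbound f hf.2 e)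
    have h2 : (f (Γ.tgt e) - f (Γ.src e)) / Γ.len e =
        (p e + (f (Γ.tgt e) - f (Γ.src e)) / Γ.len e - a e) + (a e - p e) := by ring
    have h3 : |(f (Γ.tgt e) - f (Γ.src e)) / Γ.len e| ≤ √(M / Γ.len e) + |a e - p e| := by
      rw [h2]
      exact (abs_add_le _ _).trans (add_le_add_left h1 _)
    rwa [abs_div, abs_of_pos hl, div_le_iff₀' hl] at h3
  have h0 : (0 : V → ℝ) ∈ K := ⟨rfl, le_rfl⟩
  obtain ⟨f, _, hmin⟩ := hKcpt.exists_isMinOn ⟨0, h0⟩ hcont.continuousOn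
  rw [isMinOn_iff] at hmin
  refine ⟨f, fun g => ?_⟩
  suffices Ψ f ≤ Ψ g by rwa [hΨ] at this
  by_cases hg : Ψ g ≤ Ψ 0
  · have h1 : Ψ (fun w => g w - g v) = Ψ g := by simp only [hΨ, sub_sub_sub_cancel_right]
    rw [← h1]
    exact hmin _ ⟨sub_self _, h1.trans_le hg⟩
  · exact (hmin 0 h0).trans (not_le.1 hg).le

/-- Extend the functional from harmonic forms to all of `ℝ^E`; its coordinates divided by the edge
lengths form the chain. -/
theorem exists_integral_eq (p : Γ.FormsDual) : ∃ x : E → ℝ, Γ.integral x = p := by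
  obtain ⟨φ, hφ⟩ := LinearMap.exists_extend
    ((show Γ.harmonicForms →L[ℝ] ℝ from p) : Γ.harmonicForms →ₗ[ℝ] ℝ)
  refine ⟨fun e => φ (Pi.single e 1) / Γ.len e, Γ.formsDual_ext fun ω => ?_⟩
  have h1 : Γ.evalForm ω p = φ ω := (LinearMap.congr_fun hφ ω).symm
  rw [h1, integral_apply, ← Finset.univ_sum_single (ω : E → ℝ), map_sum]
  refine Finset.sum_congr rfl fun e _ => ?_
  have h2 : (Pi.single e ((ω : E → ℝ) e) : E → ℝ) = (ω : E → ℝ) e • Pi.single e 1 := by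
    rw [← Pi.single_smul, smul_eq_mul, mul_one]
  rw [h2, map_smul, div_mul_cancel₀ _ (Γ.len_pos e).ne', smul_eq_mul, mul_comm,
    Finset.univ_sum_single]

/-- The slack of `Y` is the one-sided derivative, in the direction `-1_Y`, of the function in
`exists_minimizer`. The linear term `y` is chosen with boundary the vertex slacks, so that it
accounts for the part of the slack independent of the cube. -/
theorem exists_semistable (hH : ∀ w, 0 < H w) (v' : V) (n : ℤ) (p : Γ.FormsDual) :
    ∃ (S : Finset E) (d : V → ℤ) (ξ : E → ℤ), typeDegree S d = n ∧ Γ.IsSemistable H S d ∧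
      Γ.IsLiftChain v' S d ξ ∧ p ∈ Γ.zonotope S ξ := by
  obtain ⟨x, rfl⟩ := Γ.exists_integral_eq p
  have hκ : ∑ w, (Γ.vertexSlack H (Γ.totalSlope H n) v' n w : ℝ) = 0 := by
    exact_mod_cast Γ.sum_vertexSlack hH v' n
  obtain ⟨y, hy⟩ := Γ.exists_boundary_eq v' hκ
  obtain ⟨f, hf⟩ := Γ.exists_minimizer v' x y
  set z : E → ℝ := fun e => x e + (f (Γ.tgt e) - f (Γ.src e)) / Γ.len e with hz
  set ξ : E → ℤ := fun e => ⌊z e⌋ with hξ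
  set S : Finset E := Finset.univ.filter fun e => z e ≠ ⌊z e⌋ with hS
  have hmem : ∀ e, e ∈ S ↔ z e ≠ ⌊z e⌋ := fun e => by simp [hS]
  have hceil : ∀ e, ((⌈z e⌉ : ℝ) - 1) = ξ e - if e ∈ S then 0 else 1 := by
    intro e
    by_cases he : e ∈ S
    · have h1 : ⌈z e⌉ = ⌊z e⌋ + 1 := by
        rw [Int.ceil_eq_iff]
        push_cast
        refine ⟨?_, (Int.lt_floor_add_one _).le⟩
        rw [add_sub_cancel_right]
        exact lt_of_le_of_ne (Int.floor_le _) (Ne.symm ((hmem e).1 he))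
      rw [h1]
      simp [he, hξ]
    · have h1 : z e = ⌊z e⌋ := by rwa [hmem, not_not] at he
      have h2 : ⌈z e⌉ = ⌊z e⌋ := by
        conv_lhs => rw [h1]
        exact Int.ceil_intCast _
      simp [he, hξ, h2]
  have hn := Γ.typeDegree_chainDegree v' n S ξ
  refine ⟨S, _, ξ, hn, ?_, (Γ.isLiftChain_iff hn).2 rfl, ?_⟩
  swap
  · refine Γ.mem_zonotope.2 ⟨z, fun e _ => ⟨Int.floor_le _, (Int.lt_floor_add_one _).le⟩,
      fun e he => by rwa [hmem, not_not] at he, ?_⟩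
    have : z = x + fun e => (f (Γ.tgt e) - f (Γ.src e)) / Γ.len e := rfl
    rw [this, map_add, integral_grad, add_zero]
  rw [Γ.isSemistable_iff hH hn]
  intro Y
  rw [slack_chainDegree]
  -- Contribution of `e` to the derivative when `f` is lowered on `Y`: the coordinate of an edge
  -- leaving `Y` increases, with right slope `⌊z e⌋`, and that of an edge entering `Y` decreases,
  -- with left slope `⌈z e⌉ - 1`.
  set D : E → ℝ := fun e => if Γ.src e ∈ Y then (if Γ.tgt e ∈ Y then 0 else (ξ e - y e : ℝ))
    else if Γ.tgt e ∈ Y then y e - (⌈z e⌉ - 1) else 0 with hD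
  have hev : ∀ᶠ u in 𝓝[>] (0 : ℝ), ∀ e : E,
      stairPrimitive (z e + u / Γ.len e) = stairPrimitive (z e) + ⌊z e⌋ * (u / Γ.len e) ∧
      stairPrimitive (z e - u / Γ.len e) = stairPrimitive (z e) -
        (⌈z e⌉ - 1) * (u / Γ.len e) := by
    rw [Filter.eventually_all]
    intro e
    have ht : Tendsto (fun u : ℝ => u / Γ.len e) (𝓝[>] 0) (𝓝[>] 0) := by
      refine tendsto_nhdsWithin_iff.2 ⟨?_, ?_⟩
      · have : Tendsto (fun u : ℝ => u / Γ.len e) (𝓝 0) (𝓝 (0 / Γ.len e)) :=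
          tendsto_id.div_const _
        rw [zero_div] at this
        exact this.mono_left nhdsWithin_le_nhds
      · filter_upwards [self_mem_nhdsWithin] with u hu
        exact div_pos hu (Γ.len_pos e)
    exact (ht.eventually (stairPrimitive_add (z e))).and
      (ht.eventually (stairPrimitive_sub (z e)))
  -- A single small `u` for which no edge crosses a breakpoint, so the difference of the two values
  -- is exactly `u * ∑ e, D e`.
  obtain ⟨u, hu, hu0⟩ := (hev.and self_mem_nhdsWithin).exists
  have hu0 : 0 < u := hu0
  have hmin := hf (fun w => f w - if w ∈ Y then u else 0)
  have hsum : ∑ e, Γ.len e * (stairPrimitive (x e + ((f (Γ.tgt e) - if Γ.tgt e ∈ Y then u else 0) -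
        (f (Γ.src e) - if Γ.src e ∈ Y then u else 0)) / Γ.len e) -
      y e * (x e + ((f (Γ.tgt e) - if Γ.tgt e ∈ Y then u else 0) -
        (f (Γ.src e) - if Γ.src e ∈ Y then u else 0)) / Γ.len e)) =
      ∑ e, Γ.len e * (stairPrimitive (z e) - y e * z e) + u * ∑ e, D e := by
    rw [Finset.mul_sum, ← Finset.sum_add_distrib]
    refine Finset.sum_congr rfl fun e _ => ?_
    obtain ⟨h1, h2⟩ := hu e
    have hl := (Γ.len_pos e).ne'
    have hx : x e + ((f (Γ.tgt e) - if Γ.tgt e ∈ Y then u else 0) -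
        (f (Γ.src e) - if Γ.src e ∈ Y then u else 0)) / Γ.len e =
        z e + ((if Γ.src e ∈ Y then u else 0) - if Γ.tgt e ∈ Y then u else 0) / Γ.len e := by
      simp only [hz]
      ring
    rw [hx]
    by_cases b : Γ.src e ∈ Y <;> by_cases c : Γ.tgt e ∈ Y <;>
      simp only [b, c, hD, if_true, if_false, sub_self, zero_div, add_zero, mul_zero, sub_zero]
    · rw [h1]
      simp only [hξ]
      field_simp
      ring
    · rw [zero_sub, neg_div, ← sub_eq_add_neg, h2]
      field_simp
      ring
  rw [hsum] at hmin
  have hD0 : 0 ≤ ∑ e, D e := by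
    have : 0 ≤ u * ∑ e, D e := by linarith
    exact nonneg_of_mul_nonneg_right this hu0
  have hcast : (((∑ w ∈ Y, Γ.vertexSlack H (Γ.totalSlope H n) v' n w +
        ∑ e, if Γ.src e ∈ Y then (if Γ.tgt e ∈ Y then 0 else (ξ e : ℚ))
          else if Γ.tgt e ∈ Y then (if e ∈ S then 0 else 1) - (ξ e : ℚ) else 0 : ℚ)) : ℝ) =
      ∑ e, D e := by
    have h1 : ∑ w ∈ Y, (Γ.vertexSlack H (Γ.totalSlope H n) v' n w : ℝ) =
        ∑ w ∈ Y, Γ.boundary y w := by rw [hy]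
    push_cast
    rw [h1, sum_boundary_on, ← Finset.sum_add_distrib]
    refine Finset.sum_congr rfl fun e _ => ?_
    simp only [hD, hceil]
    by_cases a : e ∈ S <;> by_cases b : Γ.src e ∈ Y <;> by_cases c : Γ.tgt e ∈ Y <;>
      simp only [a, b, c, if_true, if_false] <;> push_cast <;> ring
  exact_mod_cast hcast ▸ hD0

/-- The periodic decompositions. -/
theorem isRefinement_polytopes (hH : ∀ w, 0 < H w) (v v' : V) (n : ℤ) :
    IsRefinement (Γ.quasistablePolytopes H v v' n) (Γ.polystablePolytopes H v' n) := by
  have hps : ∀ p, ∃ b ∈ Γ.polystablePolytopes H v' n, p ∈ b := by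
    intro p
    obtain ⟨S, d, ξ, hn, hs, hξ, hp⟩ := Γ.exists_semistable hH v' n p
    obtain ⟨S', d', hn', hps, h⟩ := Γ.exists_polystable_zonotope (v' := v') hH hn hs
    obtain ⟨ξ', hξ', hsub⟩ := h ξ hξ
    exact ⟨_, ⟨S', d', ξ', hn', hps, hξ', rfl⟩, hsub hp⟩
  have hqs : ∀ b ∈ Γ.polystablePolytopes H v' n, ∀ p ∈ b,
      ∃ a ∈ Γ.quasistablePolytopes H v v' n, a ⊆ b ∧ p ∈ a := by
    rintro _ ⟨S, d, ξ, hn, hs, hξ, rfl⟩ p hp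
    obtain ⟨S₁, d₁, ξ₁, hn₁, hq, hξ₁, hp₁, hsub⟩ :=
      Γ.exists_quasistable_face hH v v' hn hs hξ hp
    exact ⟨_, ⟨S₁, d₁, ξ₁, hn₁, hq, hξ₁, rfl⟩, hsub, hp₁⟩
  refine ⟨Set.eq_univ_of_forall fun p => ?_, Set.eq_univ_of_forall fun p => ?_, ?_, ?_⟩
  · obtain ⟨b, hb, hp⟩ := hps p
    obtain ⟨a, ha, _, hp⟩ := hqs b hb p hp
    exact ⟨a, ha, hp⟩
  · obtain ⟨b, hb, hp⟩ := hps p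
    exact ⟨b, hb, hp⟩
  · rintro _ ⟨S, d, ξ, hn, hs, hξ, rfl⟩
    obtain ⟨S', d', hn', hps, h⟩ := Γ.exists_polystable_zonotope (v' := v') hH hn hs.1
    obtain ⟨ξ', hξ', hsub⟩ := h ξ hξ
    exact ⟨_, ⟨S', d', ξ', hn', hps, hξ', rfl⟩, hsub⟩
  · intro b hb
    refine Set.Subset.antisymm (fun p hp => ?_) (Set.sUnion_subset fun a ha => ha.2)
    obtain ⟨a, ha, hab, hp⟩ := hqs b hb p hp
    exact ⟨a, ⟨ha, hab⟩, hp⟩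

/-! ### The cells of the Picard group -/

theorem boundary_intCast (ξ : E → ℤ) (w : V) :
    Γ.boundary (fun e => (ξ e : ℝ)) w = ((Γ.boundary ξ w : ℤ) : ℝ) := by
  simp [boundary]

/-- Harmonic forms are the real cycles, and the length pairing on them is positive definite. So the
lattice is the image of the integral cycles, a closed set, under an injective linear map from a
finite-dimensional space. Closedness makes the Jacobian Hausdorff. -/
theorem isClosed_lattice : IsClosed (Γ.lattice : Set Γ.FormsDual) := by
  set L : Γ.harmonicForms →ₗ[ℝ] Γ.FormsDual := Γ.integral.comp Γ.harmonicForms.subtype with hL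
  have hinj : LinearMap.ker L = ⊥ := by
    rw [LinearMap.ker_eq_bot']
    intro ω hω
    have h1 : Γ.evalForm ω (Γ.integral (ω : E → ℝ)) = 0 := by
      have : Γ.integral (ω : E → ℝ) = 0 := hω
      rw [this, map_zero]
    rw [integral_apply] at h1
    have h2 : ∀ e, (ω : E → ℝ) e * Γ.len e * (ω : E → ℝ) e = Γ.len e * (ω : E → ℝ) e ^ 2 :=
      fun e => by ring
    simp only [h2] at h1
    rw [Finset.sum_eq_zero_iff_of_nonneg fun e _ =>
      mul_nonneg (Γ.len_pos e).le (sq_nonneg _)] at h1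
    refine Subtype.ext (funext fun e => ?_)
    have := h1 e (Finset.mem_univ e)
    exact pow_eq_zero_iff two_ne_zero |>.1 ((mul_eq_zero.1 this).resolve_left (Γ.len_pos e).ne')
  have heq : (Γ.lattice : Set Γ.FormsDual) =
      L '' {ω | ∀ e, (ω : E → ℝ) e ∈ Set.range ((↑) : ℤ → ℝ)} := by
    ext p
    constructor
    · rintro ⟨ξ, hξ, rfl⟩
      refine ⟨⟨fun e => (ξ e : ℝ), funext fun w => ?_⟩, fun e => ⟨ξ e, rfl⟩, rfl⟩
      rw [boundary_intCast, hξ]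
      simp
    · rintro ⟨⟨ω, hω⟩, h, rfl⟩
      choose ξ hξ using h
      have h1 : (fun e => (ξ e : ℝ)) = ω := funext hξ
      refine ⟨ξ, funext fun w => ?_, ?_⟩
      · have h2 := congrFun (show Γ.boundary ω = 0 from hω) w
        rw [← h1, boundary_intCast, Pi.zero_apply] at h2
        rw [Pi.zero_apply]
        exact_mod_cast h2
      · change Γ.integral (fun e => (ξ e : ℝ)) = Γ.integral ω
        rw [h1]
  rw [heq]
  refine (LinearMap.isClosedEmbedding_of_injective hinj).isClosedMap _ ?_
  simp only [Set.ofPred_forall]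
  refine isClosed_iInter fun e => ?_
  exact Int.isClosedEmbedding_coe_real.isClosed_range.preimage
    ((continuous_apply e).comp continuous_subtype_val)

theorem exists_liftChain (v' : V) (S : Finset E) (d : V → ℤ) :
    Γ.IsLiftChain v' S d (∑ w, d w • Γ.path v' w + ∑ e ∈ S, Γ.path v' (Γ.src e)) := by
  let B : (E → ℤ) →+ (V → ℤ) := AddMonoidHom.mk' Γ.boundary Γ.boundary_add
  change B _ = _
  have hp : ∀ w, B (Γ.path v' w) = Pi.single w 1 - Pi.single v' 1 := Γ.boundary_path v'
  have hd : ∑ w, d w • (Pi.single w 1 : V → ℤ) = d := by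
    funext u
    simp [Finset.sum_apply, Pi.single_apply]
  simp only [map_add, map_sum, map_zsmul, hp, smul_sub, Finset.sum_sub_distrib, hd,
    ← Finset.sum_smul, Finset.sum_const, typeDegree, add_smul, natCast_zsmul]
  abel

/-- Any two lifting chains have the same boundary, so they differ by an integral cycle, whose
integral lies in the lattice; the chosen paths may thus be replaced by `ξ`. -/
theorem divisorAbelJacobi_typeDivisor {v' : V} {ξ : E → ℤ} (hξ : Γ.IsLiftChain v' S d ξ)
    (t : ∀ e : E, Set.Ioo (0 : ℝ) (Γ.len e)) :
    Γ.divisorAbelJacobi v' (Γ.typeDivisor S d t) =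
      ((Γ.intIntegral ξ + ∑ e ∈ S, ((t e : ℝ) / Γ.len e) • Γ.integral (Pi.single e 1) :
        Γ.FormsDual) : Γ.Jacobian) := by
  have hs : ∀ (p : Γ.Point) (m : ℤ), Γ.divisorAbelJacobi v' (Finsupp.single p m) =
      ((m • Γ.pathIntegral v' p : Γ.FormsDual) : Γ.Jacobian) := by
    intro p m
    rw [divisorAbelJacobi, Finsupp.liftAddHom_apply_single, zmultiplesHom_apply]
    rfl
  have h1 : Γ.divisorAbelJacobi v' (Γ.typeDivisor S d t) =
      ((∑ w, d w • Γ.intIntegral (Γ.path v' w) + ∑ e ∈ S, (Γ.intIntegral (Γ.path v' (Γ.src e)) +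
        ((t e : ℝ) / Γ.len e) • Γ.integral (Pi.single e 1)) : Γ.FormsDual) : Γ.Jacobian) := by
    rw [typeDivisor, map_add, map_sum, map_sum, QuotientAddGroup.mk_add, QuotientAddGroup.mk_sum,
      QuotientAddGroup.mk_sum]
    congr 1
    · exact Finset.sum_congr rfl fun w _ => hs _ _
    · refine Finset.sum_congr rfl fun e _ => ?_
      rw [hs, one_smul]
      rfl
  rw [h1, QuotientAddGroup.eq]
  refine ⟨ξ - (∑ w, d w • Γ.path v' w + ∑ e ∈ S, Γ.path v' (Γ.src e)), ?_, ?_⟩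
  · rw [sub_eq_add_neg, boundary_add, boundary_neg, hξ, Γ.exists_liftChain v' S d, add_neg_cancel]
  · simp only [map_sub, map_add, map_sum, map_zsmul, Finset.sum_add_distrib]
    abel

theorem degree_typeDivisor (S : Finset E) (d : V → ℤ)
    (t : ∀ e : E, Set.Ioo (0 : ℝ) (Γ.len e)) :
    Γ.degree (Γ.typeDivisor S d t) = typeDegree S d := by
  change Finsupp.liftAddHom (fun _ => AddMonoidHom.id ℤ) (Γ.typeDivisor S d t) = _
  rw [typeDivisor, map_add, map_sum, map_sum]
  simp [typeDegree]

theorem isCompact_zonotope (S : Finset E) (ξ : E → ℤ) : IsCompact (Γ.zonotope S ξ) := by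
  have h : Γ.zonotope S ξ = (fun t : E → ℝ => Γ.intIntegral ξ +
      ∑ e ∈ S, (t e / Γ.len e) • Γ.integral (Pi.single e 1)) ''
        Set.pi Set.univ fun e => Set.Icc 0 (Γ.len e) := by
    ext p
    constructor
    · rintro ⟨t, ht, rfl⟩
      refine ⟨fun e => if e ∈ S then t e else 0, fun e _ => ?_, ?_⟩
      · simp only
        split_ifs with he
        · exact ht e he
        · exact ⟨le_rfl, (Γ.len_pos e).le⟩
      · simp only
        congr 1
        exact Finset.sum_congr rfl fun e he => by rw [if_pos he]
    · rintro ⟨t, ht, rfl⟩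
      exact ⟨t, fun e _ => ht e trivial, rfl⟩
  rw [h]
  refine (isCompact_univ_pi fun e => isCompact_Icc).image ?_
  fun_prop

/-- The cell `θ_{S,d}` is the image of the zonotopes lifting it. -/
theorem mem_cell_iff {v' : V} {n : ℤ} (hn : typeDegree S d = n) {ξ : E → ℤ}
    (hξ : Γ.IsLiftChain v' S d ξ) (x : Γ.Pic n) :
    x ∈ Γ.cell v' n S d ↔
      ∃ p ∈ Γ.zonotope S ξ, (p : Γ.Jacobian) = Γ.abelJacobi v' n x := by
  have haj : ∀ (y : Γ.Pic n) (D : Γ.Divisor), (D : Γ.Divisor ⧸ Γ.principal) = y.1 →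
      Γ.abelJacobi v' n y = Γ.divisorAbelJacobi v' D := by
    intro y D h
    rw [abelJacobi, ← h]
    rfl
  have hmk : Continuous fun p : Γ.FormsDual => (p : Γ.Jacobian) := continuous_quotient_mk'
  -- A closure in an induced topology is the preimage of the closure of the image, so injectivity of
  -- the Abel–Jacobi map plays no role.
  rw [cell, closure_induced]
  suffices closure (Γ.abelJacobi v' n '' Γ.openCell n S d) =
      (fun p : Γ.FormsDual => (p : Γ.Jacobian)) '' Γ.zonotope S ξ by
    rw [this]; rfl
  refine Set.Subset.antisymm (closure_minimal ?_ ?_) ?_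
  · rintro _ ⟨y, ⟨D, ⟨t, rfl⟩, hy⟩, rfl⟩
    refine ⟨_, ⟨fun e => t e, fun e _ => ⟨(t e).2.1.le, (t e).2.2.le⟩, rfl⟩, ?_⟩
    rw [haj y _ hy, Γ.divisorAbelJacobi_typeDivisor hξ]
  · have := Γ.isClosed_lattice
    exact ((Γ.isCompact_zonotope S ξ).image hmk).isClosed
  · rintro _ ⟨_, ⟨t, ht, rfl⟩, rfl⟩
    -- Parameters on the boundary of the cube are pushed towards the midpoints of the edges, giving
    -- divisors of type `(S, d)` that tend to the given point as `s` tends to zero. Off `S` the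
    -- midpoint is a dummy value.
    set T : ℝ → E → ℝ := fun s e => if e ∈ S then (1 - s) * t e + s * (Γ.len e / 2)
      else Γ.len e / 2 with hT
    have hTI : ∀ s ∈ Set.Ioo (0 : ℝ) 1, ∀ e, T s e ∈ Set.Ioo (0 : ℝ) (Γ.len e) := by
      rintro s ⟨hs0, hs1⟩ e
      have hl := Γ.len_pos e
      by_cases he : e ∈ S
      · obtain ⟨h1, h2⟩ := ht e he
        simp only [hT, he, if_true]
        have h3 := mul_nonneg (sub_nonneg.2 hs1.le) h1
        have h4 := mul_nonneg (sub_nonneg.2 hs1.le) (sub_nonneg.2 h2)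
        have h5 := mul_pos hs0 hl
        constructor <;> linarith
      · simp only [hT, he, if_false]
        constructor <;> linarith
    set F : ℝ → Γ.FormsDual := fun s => Γ.intIntegral ξ +
      ∑ e ∈ S, (T s e / Γ.len e) • Γ.integral (Pi.single e 1) with hF
    have hFc : Continuous F := by
      refine continuous_const.add (continuous_finsetSum _ fun e he => ?_)
      refine Continuous.smul (f := fun s => T s e / Γ.len e) (Continuous.div_const ?_ _)
        continuous_const
      simp only [hT, he, if_true]
      fun_prop
    have hF0 : F 0 = Γ.intIntegral ξ +
        ∑ e ∈ S, (t e / Γ.len e) • Γ.integral (Pi.single e 1) := by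
      simp only [hF]
      congr 1
      refine Finset.sum_congr rfl fun e he => ?_
      simp [hT, he]
    rw [← hF0]
    refine mem_closure_of_tendsto (f := fun s => ((F s : Γ.FormsDual) : Γ.Jacobian))
      (b := 𝓝[>] (0 : ℝ)) (((hmk.comp hFc).tendsto 0).mono_left nhdsWithin_le_nhds) ?_
    filter_upwards [Ioo_mem_nhdsGT (zero_lt_one' ℝ)] with s hs
    let t' : ∀ e : E, Set.Ioo (0 : ℝ) (Γ.len e) := fun e => ⟨T s e, hTI s hs e⟩
    let y : Γ.Pic n := ⟨(Γ.typeDivisor S d t' : Γ.Divisor ⧸ Γ.principal), Γ.typeDivisor S d t',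
      (Γ.degree_typeDivisor S d t').trans hn, rfl⟩
    refine ⟨y, ⟨_, ⟨t', rfl⟩, rfl⟩, ?_⟩
    rw [haj y _ rfl, Γ.divisorAbelJacobi_typeDivisor hξ]

theorem cell_subset {v' : V} {n : ℤ} {ξ ξ' : E → ℤ} (hn : typeDegree S d = n)
    (hn' : typeDegree S' d' = n) (hξ : Γ.IsLiftChain v' S d ξ) (hξ' : Γ.IsLiftChain v' S' d' ξ')
    (h : Γ.zonotope S ξ ⊆ Γ.zonotope S' ξ') : Γ.cell v' n S d ⊆ Γ.cell v' n S' d' := by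
  intro x hx
  obtain ⟨p, hp, hpx⟩ := (Γ.mem_cell_iff hn hξ x).1 hx
  exact (Γ.mem_cell_iff hn' hξ' x).2 ⟨p, h hp, hpx⟩

/-- The decompositions of the Picard group. -/
theorem isRefinement_cells (hH : ∀ w, 0 < H w) (v v' : V) (n : ℤ) :
    IsRefinement (Γ.quasistableCells H v v' n) (Γ.polystableCells H v' n) := by
  have hps : ∀ x, ∃ b ∈ Γ.polystableCells H v' n, x ∈ b := by
    intro x
    obtain ⟨p, hp⟩ := QuotientAddGroup.mk_surjective (Γ.abelJacobi v' n x)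
    obtain ⟨b, ⟨S, d, ξ, hn, hs, hξ, rfl⟩, hpb⟩ :=
      (Set.eq_univ_iff_forall.1 (Γ.isRefinement_polytopes hH v v' n).2.1) p
    exact ⟨_, ⟨S, d, hn, hs, rfl⟩, (Γ.mem_cell_iff hn hξ x).2 ⟨p, hpb, hp⟩⟩
  have hqs : ∀ b ∈ Γ.polystableCells H v' n, ∀ x ∈ b,
      ∃ a ∈ Γ.quasistableCells H v v' n, a ⊆ b ∧ x ∈ a := by
    rintro _ ⟨S, d, hn, hs, rfl⟩ x hx
    have hξ := Γ.exists_liftChain v' S d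
    obtain ⟨p, hp, hpx⟩ := (Γ.mem_cell_iff hn hξ x).1 hx
    obtain ⟨S₁, d₁, ξ₁, hn₁, hq, hξ₁, hp₁, hsub⟩ :=
      Γ.exists_quasistable_face hH v v' hn hs hξ hp
    exact ⟨_, ⟨S₁, d₁, hn₁, hq, rfl⟩, Γ.cell_subset hn₁ hn hξ₁ hξ hsub,
      (Γ.mem_cell_iff hn₁ hξ₁ x).2 ⟨p, hp₁, hpx⟩⟩
  refine ⟨Set.eq_univ_of_forall fun x => ?_, Set.eq_univ_of_forall fun x => ?_, ?_, ?_⟩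
  · obtain ⟨b, hb, hx⟩ := hps x
    obtain ⟨a, ha, _, hx⟩ := hqs b hb x hx
    exact ⟨a, ha, hx⟩
  · obtain ⟨b, hb, hx⟩ := hps x
    exact ⟨b, hb, hx⟩
  · rintro _ ⟨S, d, hn, hs, rfl⟩
    have hξ := Γ.exists_liftChain v' S d
    obtain ⟨S', d', hn', hps, h⟩ := Γ.exists_polystable_zonotope (v' := v') hH hn hs.1
    obtain ⟨ξ', hξ', hsub⟩ := h _ hξ
    exact ⟨_, ⟨S', d', hn', hps, rfl⟩, Γ.cell_subset hn hn' hξ hξ' hsub⟩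
  · intro b hb
    refine Set.Subset.antisymm (fun x hx => ?_) (Set.sUnion_subset fun a ha => ha.2)
    obtain ⟨a, ha, hab, hx⟩ := hqs b hb x hx
    exact ⟨a, ⟨ha, hab⟩, hx⟩

end

end MetricGraph

theorem mainTheorem8 {V E : Type*} [Fintype V] [Fintype E] [DecidableEq V] [DecidableEq E]
    (Γ : MetricGraph V E) (H : V → ℕ) (hH : ∀ w, 0 < H w) (v v' : V) (n : ℤ) :
    IsRefinement (Γ.quasistableCells H v v' n) (Γ.polystableCells H v' n) ∧
      IsRefinement (Γ.quasistablePolytopes H v v' n) (Γ.polystablePolytopes H v' n) := by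
  exact ⟨Γ.isRefinement_cells hH v v' n, Γ.isRefinement_polytopes hH v v' n⟩
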